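/- For positive integers $s_1,\dots,s_k$ with $s_1\ge 2$ let \[ \zeta(s_1,\dots,s_k)=\sum_{n_1>n_2>\cdots>n_k>0}\ \prod_{j=1}^k n_j^{-s_j} \] be the (absolutely convergent) multiple zeta value, the sum being over $k$-tuples of positive integers, with $\zeta()=1$ for the empty list of arguments ($k=0$). For a finite string $S$ of positive integers write $\{S\}^n$ for the string $S$ repeated $n$ times. Then for every integer $n\ge 0$, \[ \zeta(2,\{1,3\}^n) =4^{-n}\sum_{k=0}^n(-1)^k\,\zeta(\{4\}^{n-k}) \Bigl\{(4k+1)\,\zeta(4k+2)-4\sum_{j=1}^k\zeta(4j-1)\,\zeta(4k-4j+3)\Bigr\}, \] where all the series involved, namely those defining $\zeta(2,\{1,3\}^n)$, $\zeta(\{4\}^m)$ for $m\ge 0$ and $\zeta(m)$ for $m\ge 2$, converge absolutely. -/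

import Mathlib

/-- The index set of the multiple zeta value of depth `k`: the strictly decreasing
`k`-tuples `n₁ > n₂ > ⋯ > n_k > 0` of positive integers. -/
def MZVIndex (k : ℕ) : Type :=
  {n : Fin k → ℕ // StrictAnti n ∧ ∀ i, 0 < n i}

/-- The general term `∏ⱼ nⱼ ^ (-sⱼ)` of the multiple zeta series with arguments `s₁, …, s_k`. -/
noncomputable def mzvTerm (s : List ℕ) (n : MZVIndex s.length) : ℝ :=
  ∏ j : Fin s.length, ((n.1 j : ℝ) ^ s.get j)⁻¹

/-- The multiple zeta series `ζ(s₁, …, s_k)` converges (absolutely). -/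
def MZVConverges (s : List ℕ) : Prop :=
  Summable (mzvTerm s)

/-- The multiple zeta value `ζ(s₁, …, s_k) = ∑_{n₁ > ⋯ > n_k > 0} ∏ⱼ nⱼ ^ (-sⱼ)`.
The value at the empty list of arguments is `1`, and depth one is the usual `ζ(s)`. -/
noncomputable def mzv (s : List ℕ) : ℝ :=
  ∑' n : MZVIndex s.length, mzvTerm s n

/-- The concatenation power `{s}^n`: the string `s` repeated `n` times. -/
def stringPow (s : List ℕ) (n : ℕ) : List ℕ :=
  (List.replicate n s).flatten

/-! Work with formal power series in `X` whose coefficients are functions of `z` on (0,1). The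
system z y' = q, (1-z) q' = X y has a solution u = `regSol`, regular at 0, whose limit at 1 is P =
`sineSeries` (in closed form sinh(π√X)/(π√X)), and a solution v = `logSol` = u log z + `logPart`.
Write f* for f with X replaced by -X.

A product of a solution for X and one for -X is multiplied by -4X² under z d/dz twice followed by
(1-z) d/dz twice. These are the operators that strip the string 3,1 from a polylogarithm. Matching
behaviour at 0 shows that Y = u v* - v u* satisfies z Y' = 4X ∑ (-4X²)ⁿ Li(2,{1,3}ⁿ; z)
(`coeff_antiProdThetaThree`, `coeff_antiProd_of_coeff_three`), so its limit at 1 generates the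
wanted values.

That limit is also computable from the connection between 0 and 1. The map z ↦ 1-z preserves the
system, and Wronskians are constant, so the derivatives of u and v, which are not controlled
directly at 1, can be eliminated in favour of u(1), v(1) and the behaviour at 0
(`antiProdTheta_mul`, `cyclicSeries_mul_sineSeries`). With v(1) = d = -2 P t, t = `zetaSeries 1`,
the outcome is 4X · `cyclicSeries` · P P* = P² - P*² - X (P d* - P* d)². The last term yields the
products of odd zeta values. For the first two, 1/P² is expressed through π√X coth(π√X), whose
coefficients are even zeta values (`sineSeries_sq_mul`). Finally P P* = ∏ (1 - X²/k⁴) generates the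
ζ({4}ᵐ) (`sineSeries_mul_evalNeg`), and comparing coefficients in `cyclicSeries_eq` finishes the
proof. -/

open Filter Topology PowerSeries
open scoped PowerSeries.WithPiTopology

/-! ### Truncated multiple zeta values and convergence -/

/-- The truncated multiple zeta value: the sum over `N ≥ n₁ > ⋯ > n_k > 0`. -/
noncomputable def mzvPartial : List ℕ → ℕ → ℝ
  | [], _ => 1
  | s :: r, N => ∑ m ∈ Finset.range N, (((m + 1 : ℕ) : ℝ) ^ s)⁻¹ * mzvPartial r m

/-- The decreasing tuples of positive integers with entries at most `N`. -/
noncomputable def mzvBox (k N : ℕ) : Finset (Fin k → ℕ) := by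
  classical
  exact (Fintype.piFinset fun _ => Finset.Icc 1 N).filter StrictAnti

theorem mem_mzvBox {k N : ℕ} {n : Fin k → ℕ} :
    n ∈ mzvBox k N ↔ (∀ i, 1 ≤ n i ∧ n i ≤ N) ∧ StrictAnti n := by
  simp [mzvBox, Fintype.mem_piFinset]

theorem strictAnti_cons_iff {k : ℕ} {a : ℕ} {n : Fin k → ℕ} :
    StrictAnti (Fin.cons a n : Fin (k + 1) → ℕ) ↔ (∀ i, n i < a) ∧ StrictAnti n := by
  constructor
  · intro h
    refine ⟨fun i => ?_, fun i j hij => ?_⟩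
    · simpa using h (Fin.succ_pos i)
    · simpa using h (Fin.succ_lt_succ_iff.2 hij)
  · rintro ⟨h0, h⟩ i j hij
    induction j using Fin.cases with
    | zero => exact absurd hij (Fin.not_lt_zero _)
    | succ j =>
      induction i using Fin.cases with
      | zero => simpa using h0 j
      | succ i => simpa using h (Fin.succ_lt_succ_iff.1 hij)

theorem sum_mzvBox (s : List ℕ) (N : ℕ) :
    ∑ n ∈ mzvBox s.length N, ∏ j : Fin s.length, ((n j : ℝ) ^ s.get j)⁻¹ = mzvPartial s N := by
  induction s generalizing N with
  | nil =>
    have : mzvBox ([] : List ℕ).length N = {Fin.elim0} := by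
      ext n
      simp only [mem_mzvBox, Finset.mem_singleton]
      constructor
      · intro _; exact Subsingleton.elim (α := Fin 0 → ℕ) _ _
      · intro _; exact ⟨fun i => i.elim0, fun i => i.elim0⟩
    rw [this]
    simp [mzvPartial]
  | cons a s ih =>
    simp only [mzvPartial, ← ih, Finset.mul_sum]
    rw [Finset.sum_sigma']
    refine Finset.sum_bij' (fun n _ => ⟨n 0 - 1, fun i => n i.succ⟩)
      (fun p _ => (Fin.cons (p.1 + 1) p.2 : Fin (s.length + 1) → ℕ)) ?_ ?_ ?_ ?_ ?_
    · intro n hn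
      obtain ⟨h1, h2⟩ := mem_mzvBox.1 hn
      simp only [Finset.mem_sigma, Finset.mem_range, mem_mzvBox]
      refine ⟨?_, ⟨fun i => ⟨(h1 _).1, ?_⟩, fun i j hij => h2 (Fin.succ_lt_succ_iff.2 hij)⟩⟩
      · have := h1 0; omega
      · have : n i.succ < n 0 := h2 (Fin.succ_pos i)
        omega
    · rintro ⟨m, n⟩ hn
      simp only [Finset.mem_sigma, Finset.mem_range, mem_mzvBox] at hn
      obtain ⟨hm, h1, h2⟩ := hn
      refine mem_mzvBox.2 ⟨fun i => ?_, strictAnti_cons_iff.2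
        ⟨fun i => Nat.lt_succ_of_le (h1 i).2, h2⟩⟩
      induction i using Fin.cases with
      | zero => simp; omega
      | succ i => have := h1 i; simp; omega
    · intro n hn
      obtain ⟨h1, h2⟩ := mem_mzvBox.1 hn
      funext i
      induction i using Fin.cases with
      | zero => have := h1 0; simp; omega
      | succ i => simp
    · rintro ⟨m, n⟩ hn
      simp
    · intro n hn
      obtain ⟨h1, h2⟩ := mem_mzvBox.1 hn
      have h0 : n 0 - 1 + 1 = n 0 := by have := h1 0; omega
      rw [show (∏ j : Fin (a :: s).length, ((n j : ℝ) ^ (a :: s).get j)⁻¹)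
        = ∏ j : Fin (s.length + 1), ((n j : ℝ) ^ (a :: s).get j)⁻¹ from rfl, Fin.prod_univ_succ]
      simp only [h0]
      rfl

theorem mzvPartial_nonneg (s : List ℕ) (N : ℕ) : 0 ≤ mzvPartial s N := by
  induction s generalizing N with
  | nil => simp [mzvPartial]
  | cons a s ih => exact Finset.sum_nonneg fun m _ => mul_nonneg (by positivity) (ih m)

theorem mzvPartial_monotone (s : List ℕ) : Monotone (mzvPartial s) := by
  cases s with
  | nil => intro a b _; simp [mzvPartial]
  | cons a s =>
    intro M N h
    exact Finset.sum_le_sum_of_subset_of_nonneg (Finset.range_mono h)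
      fun m _ _ => mul_nonneg (by positivity) (mzvPartial_nonneg s m)

/-- The terms are nonnegative and the boxes exhaust the index set, so convergence of the truncations
already forces unconditional convergence to the same value. -/
theorem hasSum_mzvTerm {s : List ℕ} {S : ℝ} (h : Tendsto (mzvPartial s) atTop (𝓝 S)) :
    HasSum (mzvTerm s) S := by
  classical
  let B : ℕ → Finset (MZVIndex s.length) := fun N =>
    Finset.subtype (fun n : Fin s.length → ℕ => StrictAnti n ∧ ∀ i, 0 < n i) (mzvBox s.length N)
  have hB : ∀ N (x : MZVIndex s.length), x ∈ B N ↔ x.1 ∈ mzvBox s.length N :=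
    fun N x => Finset.mem_subtype
  have hBmono : Monotone B := by
    intro M N hMN x hx
    rw [hB, mem_mzvBox] at *
    exact ⟨fun i => ⟨(hx.1 i).1, (hx.1 i).2.trans hMN⟩, hx.2⟩
  have hBex : ∀ x, ∃ N, x ∈ B N := by
    intro x
    refine ⟨∑ i, x.1 i, ?_⟩
    rw [hB, mem_mzvBox]
    exact ⟨fun i => ⟨x.2.2 i, Finset.single_le_sum (fun _ _ => Nat.zero_le _) (Finset.mem_univ i)⟩,
      x.2.1⟩
  have hsum : ∀ N, ∑ x ∈ B N, mzvTerm s x = mzvPartial s N := by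
    intro N
    rw [← sum_mzvBox]
    refine Finset.sum_bij (fun x _ => x.1) (fun x hx => (hB N x).1 hx)
      (fun x _ y _ hxy => Subtype.ext hxy) (fun n hn => ?_) (fun x _ => rfl)
    have h' := mem_mzvBox.1 hn
    exact ⟨⟨n, h'.2, fun i => (h'.1 i).1⟩, (hB N _).2 hn, rfl⟩
  have hle : ∀ N, mzvPartial s N ≤ S := fun N => (mzvPartial_monotone s).ge_of_tendsto h N
  have hnn : ∀ x, 0 ≤ mzvTerm s x := fun x => Finset.prod_nonneg fun _ _ => by positivity
  have htend := tendsto_atTop_finset_of_monotone hBmono hBex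
  have hS : Summable (mzvTerm s) := by
    refine summable_of_sum_le hnn (c := S) fun t => ?_
    obtain ⟨N, hN⟩ := (htend.eventually (eventually_ge_atTop t)).exists
    exact (Finset.sum_le_sum_of_subset_of_nonneg hN fun x _ _ => hnn x).trans
      ((hsum N).le.trans (hle N))
  have h2 : Tendsto (fun N => ∑ x ∈ B N, mzvTerm s x) atTop (𝓝 (∑' x, mzvTerm s x)) :=
    hS.hasSum.comp htend
  simp only [hsum] at h2
  rw [tendsto_nhds_unique h h2]
  exact hS.hasSum

/-- Dropping the ordering of the indices and lowering all exponents to 1 leaves a power of a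
harmonic number. The resulting logarithmic growth is what a leading exponent of at least 2 can
absorb. -/
theorem mzvPartial_le_pow_harmonic {s : List ℕ} (hs : ∀ a ∈ s, 1 ≤ a) (N : ℕ) :
    mzvPartial s N ≤ ((harmonic N : ℚ) : ℝ) ^ s.length := by
  induction s generalizing N with
  | nil => simp [mzvPartial]
  | cons a s ih =>
    have hN : ∀ n, ((harmonic n : ℚ) : ℝ) = ∑ i ∈ Finset.range n, (((i + 1 : ℕ) : ℝ))⁻¹ := by
      intro n; simp [harmonic]
    rw [List.length_cons, pow_succ']
    nth_rewrite 1 [hN]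
    rw [Finset.sum_mul]
    refine Finset.sum_le_sum fun m hm => ?_
    refine mul_le_mul ?_ ?_ (mzvPartial_nonneg _ _) (by positivity)
    · refine inv_anti₀ (by positivity) ?_
      exact le_self_pow₀ (by exact_mod_cast Nat.succ_le_succ (Nat.zero_le m))
        (Nat.one_le_iff_ne_zero.1 (hs a (by simp)))
    · refine (ih (fun b hb => hs b (by simp [hb])) m).trans ?_
      have hnn : ∀ n, (0 : ℝ) ≤ ((harmonic n : ℚ) : ℝ) := fun n => by rw [hN]; positivity
      refine pow_le_pow_left₀ (hnn m) ?_ _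
      rw [hN, hN]
      exact Finset.sum_le_sum_of_subset_of_nonneg
        (Finset.range_mono (Finset.mem_range.1 hm).le) fun i _ _ => by positivity

/-- A crude bound suffices for generating functions inside the unit disc, and it also covers strings
with leading entry 1, whose series diverge. -/
theorem mzvPartial_le_pow {s : List ℕ} (hs : ∀ a ∈ s, 1 ≤ a) (N : ℕ) :
    mzvPartial s N ≤ ((N : ℝ) + 1) ^ s.length := by
  induction s generalizing N with
  | nil => simp [mzvPartial]
  | cons a s ih =>
    have hb : ∀ m ∈ Finset.range N, (((m + 1 : ℕ) : ℝ) ^ a)⁻¹ * mzvPartial s m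
        ≤ ((N : ℝ) + 1) ^ s.length := by
      intro m hm
      have h1 : (((m + 1 : ℕ) : ℝ) ^ a)⁻¹ ≤ 1 :=
        inv_le_one_of_one_le₀ (one_le_pow₀ (by exact_mod_cast Nat.succ_le_succ (Nat.zero_le m)))
      have h2 := ih (fun b hb => hs b (by simp [hb])) m
      have h3 : ((m : ℝ) + 1) ^ s.length ≤ ((N : ℝ) + 1) ^ s.length := by
        have : (m : ℝ) ≤ N := by exact_mod_cast (Finset.mem_range.1 hm).le
        gcongr
      calc _ ≤ 1 * mzvPartial s m := by
            exact mul_le_mul_of_nonneg_right h1 (mzvPartial_nonneg _ _)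
        _ ≤ _ := by linarith
    have := Finset.sum_le_card_nsmul _ _ _ hb
    simp only [Finset.card_range, nsmul_eq_mul] at this
    rw [List.length_cons, pow_succ']
    refine this.trans ?_
    have : (0 : ℝ) ≤ ((N : ℝ) + 1) ^ s.length := by positivity
    nlinarith

theorem summable_inv_sq_mul_log_pow (d : ℕ) :
    Summable fun m : ℕ => (((m + 1 : ℕ) : ℝ) ^ 2)⁻¹ * (1 + Real.log ((m + 1 : ℕ) : ℝ)) ^ d := by
  -- The exponent is chosen so that its `d`-th power contributes at most x^(1/2), leaving a summable
  -- x^(-3/2).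
  have h0 : (fun x : ℝ => 1 + Real.log x) =o[atTop] fun x => x ^ (1 / (2 * ((d : ℝ) + 1))) := by
    refine Asymptotics.IsLittleO.add ?_ (isLittleO_log_rpow_atTop (by positivity))
    exact Asymptotics.isLittleO_const_left.2 (Or.inr
      (tendsto_norm_atTop_atTop.comp (tendsto_rpow_atTop (by positivity))))
  have h1 : (fun x : ℝ => (x ^ 2)⁻¹ * (1 + Real.log x) ^ d) =O[atTop]
      fun x => x ^ (-(3 / 2) : ℝ) := by
    have h2 := (Asymptotics.isBigO_refl (fun x : ℝ => (x ^ 2)⁻¹) atTop).mul (h0.isBigO.pow d)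
    refine h2.trans (Asymptotics.IsBigO.of_bound 1 ?_)
    filter_upwards [eventually_ge_atTop 1] with x hx
    have hx0 : (0 : ℝ) < x := by linarith
    rw [one_mul, Real.norm_of_nonneg (by positivity), Real.norm_of_nonneg (by positivity),
      ← Real.rpow_natCast, ← Real.rpow_natCast, ← Real.rpow_neg hx0.le, ← Real.rpow_mul hx0.le,
      ← Real.rpow_add hx0]
    refine Real.rpow_le_rpow_of_exponent_le hx ?_
    have : 1 / (2 * ((d : ℝ) + 1)) * d ≤ 1 / 2 := by
      rw [div_mul_eq_mul_div, div_le_div_iff₀ (by positivity) (by norm_num)]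
      linarith
    push_cast
    linarith
  have h2 : Summable fun m : ℕ => ((m : ℝ) ^ 2)⁻¹ * (1 + Real.log (m : ℝ)) ^ d :=
    summable_of_isBigO_nat (Real.summable_nat_rpow.2 (by norm_num : (-(3 / 2) : ℝ) < -1))
      (h1.comp_tendsto tendsto_natCast_atTop_atTop)
  exact (summable_nat_add_iff 1).2 h2

theorem tendsto_mzvPartial_of_two_le {a : ℕ} {s : List ℕ} (ha : 2 ≤ a) (hs : ∀ b ∈ s, 1 ≤ b) :
    ∃ S, Tendsto (mzvPartial (a :: s)) atTop (𝓝 S) := by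
  have hsum : Summable fun m : ℕ => (((m + 1 : ℕ) : ℝ) ^ a)⁻¹ * mzvPartial s m := by
    refine Summable.of_nonneg_of_le (fun m => mul_nonneg (by positivity) (mzvPartial_nonneg _ _))
      (fun m => ?_) (summable_inv_sq_mul_log_pow s.length)
    have h1 : (1 : ℝ) ≤ ((m + 1 : ℕ) : ℝ) := by exact_mod_cast Nat.succ_le_succ (Nat.zero_le m)
    refine mul_le_mul ?_ ?_ (mzvPartial_nonneg _ _) (by positivity)
    · exact inv_anti₀ (by positivity) (pow_le_pow_right₀ h1 ha)
    · refine (mzvPartial_monotone s m.le_succ).trans ((mzvPartial_le_pow_harmonic hs _).trans ?_)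
      refine pow_le_pow_left₀ ?_ (harmonic_le_one_add_log _) _
      exact_mod_cast (harmonic_pos (Nat.succ_ne_zero m)).le
  exact ⟨_, hsum.hasSum.tendsto_sum_nat⟩

theorem MZVConverges.of_two_le {a : ℕ} {s : List ℕ} (ha : 2 ≤ a) (hs : ∀ b ∈ s, 1 ≤ b) :
    MZVConverges (a :: s) := by
  obtain ⟨S, hS⟩ := tendsto_mzvPartial_of_two_le ha hs
  exact (hasSum_mzvTerm hS).summable

theorem tendsto_mzvPartial {a : ℕ} {s : List ℕ} (ha : 2 ≤ a) (hs : ∀ b ∈ s, 1 ≤ b) :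
    Tendsto (mzvPartial (a :: s)) atTop (𝓝 (mzv (a :: s))) := by
  obtain ⟨S, hS⟩ := tendsto_mzvPartial_of_two_le ha hs
  rwa [mzv, (hasSum_mzvTerm hS).tsum_eq]

theorem mzv_nil : mzv [] = 1 := by
  rw [mzv, (hasSum_mzvTerm (s := []) (S := 1) (by simp [mzvPartial])).tsum_eq]

theorem stringPow_zero (s : List ℕ) : stringPow s 0 = [] := rfl

theorem stringPow_succ (s : List ℕ) (n : ℕ) : stringPow s (n + 1) = s ++ stringPow s n := by
  simp [stringPow, List.replicate_succ]

theorem one_le_of_mem_stringPow {s : List ℕ} (hs : ∀ a ∈ s, 1 ≤ a) (n : ℕ) :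
    ∀ a ∈ stringPow s n, 1 ≤ a := by
  intro a ha
  simp only [stringPow, List.mem_flatten, List.mem_replicate] at ha
  obtain ⟨l, ⟨_, rfl⟩, h⟩ := ha
  exact hs a h

theorem tendsto_mzvPartial_stringPow_singleton {a : ℕ} (ha : 2 ≤ a) (n : ℕ) :
    Tendsto (mzvPartial (stringPow [a] n)) atTop (𝓝 (mzv (stringPow [a] n))) := by
  cases n with
  | zero => simp [stringPow_zero, mzv_nil, mzvPartial]
  | succ n =>
    rw [stringPow_succ]
    exact tendsto_mzvPartial ha (one_le_of_mem_stringPow (by simp; omega) n)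

theorem MZVConverges.stringPow_singleton {a : ℕ} (ha : 2 ≤ a) (n : ℕ) :
    MZVConverges (stringPow [a] n) :=
  (hasSum_mzvTerm (tendsto_mzvPartial_stringPow_singleton ha n)).summable

/-! ### Generating functions of polynomially bounded sequences -/

/-- A sequence of real numbers bounded by a polynomial. -/
def PolyBdd (a : ℕ → ℝ) : Prop := ∃ (C : ℝ) (k : ℕ), ∀ m : ℕ, |a m| ≤ C * ((m : ℝ) + 1) ^ k

theorem PolyBdd.of_tendsto {a : ℕ → ℝ} {l : ℝ} (h : Tendsto a atTop (𝓝 l)) : PolyBdd a := by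
  obtain ⟨C, hC⟩ := (Metric.isBounded_range_of_tendsto a h).exists_norm_le
  exact ⟨C, 0, fun m => by simpa using hC _ ⟨m, rfl⟩⟩

theorem PolyBdd.shift {a : ℕ → ℝ} (h : PolyBdd a) : PolyBdd fun m => a (m + 1) := by
  obtain ⟨C, k, h⟩ := h
  have hC : 0 ≤ C := by simpa using (abs_nonneg _).trans (h 0)
  refine ⟨C * 2 ^ k, k, fun m => (h (m + 1)).trans ?_⟩
  rw [mul_assoc, ← mul_pow]
  push_cast
  gcongr
  linarith

theorem PolyBdd.of_shift {a : ℕ → ℝ} (h : PolyBdd fun m => a (m + 1)) : PolyBdd a := by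
  obtain ⟨C, k, h⟩ := h
  have hC : 0 ≤ C := by simpa using (abs_nonneg _).trans (h 0)
  refine ⟨C + |a 0|, k, fun m => ?_⟩
  cases m with
  | zero => simpa using hC
  | succ m =>
    refine (h m).trans ?_
    have : C ≤ C + |a 0| := by linarith [abs_nonneg (a 0)]
    push_cast
    gcongr
    linarith

theorem PolyBdd.add {a b : ℕ → ℝ} (ha : PolyBdd a) (hb : PolyBdd b) :
    PolyBdd fun m => a m + b m := by
  obtain ⟨C, k, ha⟩ := ha
  obtain ⟨D, l, hb⟩ := hb
  have hC : 0 ≤ C := by simpa using (abs_nonneg _).trans (ha 0)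
  have hD : 0 ≤ D := by simpa using (abs_nonneg _).trans (hb 0)
  refine ⟨C + D, k + l, fun m => (abs_add_le _ _).trans ?_⟩
  have h1 : (1 : ℝ) ≤ (m : ℝ) + 1 := by linarith [(Nat.cast_nonneg m : (0 : ℝ) ≤ m)]
  rw [add_mul]
  refine add_le_add ((ha m).trans ?_) ((hb m).trans ?_)
  · exact mul_le_mul_of_nonneg_left (pow_le_pow_right₀ h1 (by omega)) hC
  · exact mul_le_mul_of_nonneg_left (pow_le_pow_right₀ h1 (by omega)) hD

theorem PolyBdd.const_mul {a : ℕ → ℝ} (ha : PolyBdd a) (c : ℝ) : PolyBdd fun m => c * a m := by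
  obtain ⟨C, k, ha⟩ := ha
  refine ⟨|c| * C, k, fun m => ?_⟩
  rw [abs_mul, mul_assoc]
  exact mul_le_mul_of_nonneg_left (ha m) (abs_nonneg c)

theorem PolyBdd.nat_mul {a : ℕ → ℝ} (ha : PolyBdd a) : PolyBdd fun m => (m : ℝ) * a m := by
  obtain ⟨C, k, ha⟩ := ha
  refine ⟨C, k + 1, fun m => ?_⟩
  rw [abs_mul, pow_succ, ← mul_assoc, mul_comm, abs_of_nonneg (Nat.cast_nonneg m : (0 : ℝ) ≤ m)]
  exact mul_le_mul (ha m) (by linarith) (by positivity) ((abs_nonneg _).trans (ha m))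

/-- The difference sequence of `S`, with initial term `S 0`. -/
def diffSeq {A : Type*} [Sub A] (S : ℕ → A) : ℕ → A
  | 0 => S 0
  | m + 1 => S (m + 1) - S m

theorem sum_range_succ_diffSeq {A : Type*} [AddCommGroup A] (S : ℕ → A) (N : ℕ) :
    ∑ m ∈ Finset.range (N + 1), diffSeq S m = S N := by
  induction N with
  | zero => simp [diffSeq]
  | succ N ih => rw [Finset.sum_range_succ, ih]; simp [diffSeq]

theorem PolyBdd.diffSeq {S : ℕ → ℝ} (h : PolyBdd S) : PolyBdd (diffSeq S) := by
  refine PolyBdd.of_shift ?_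
  simpa [_root_.diffSeq, sub_eq_add_neg] using h.shift.add (h.const_mul (-1))

/-- The generating function `∑ aₘ zᵐ`. -/
noncomputable def gf (a : ℕ → ℝ) (z : ℝ) : ℝ := ∑' m, a m * z ^ m

theorem PolyBdd.summable {a : ℕ → ℝ} (h : PolyBdd a) {z : ℝ} (hz : |z| < 1) :
    Summable fun m => |a m| * |z| ^ m := by
  obtain ⟨C, k, h⟩ := h
  have h0 : Summable fun m : ℕ => ((m : ℝ) + 1) ^ k * |z| ^ m := by
    have := summable_norm_mul_geometric_of_norm_lt_one (R := ℝ) (k := k) (u := fun n => (n + 1) ^ k)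
      (r := |z|) (by simpa using hz) (by
        refine Asymptotics.IsBigO.of_bound (2 ^ k) ?_
        filter_upwards [eventually_ge_atTop 1] with n hn
        have : (1 : ℝ) ≤ n := by exact_mod_cast hn
        push_cast
        rw [Real.norm_of_nonneg (by positivity), Real.norm_of_nonneg (by positivity), ← mul_pow]
        gcongr
        linarith)
    refine this.congr fun m => ?_
    rw [Real.norm_of_nonneg (by positivity)]
    push_cast
    rfl
  refine Summable.of_nonneg_of_le (fun m => by positivity) (fun m => ?_) (h0.mul_left C)
  rw [← mul_assoc]
  exact mul_le_mul_of_nonneg_right (h m) (by positivity)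

theorem PolyBdd.summable_gf {a : ℕ → ℝ} (h : PolyBdd a) {z : ℝ} (hz : |z| < 1) :
    Summable fun m => a m * z ^ m :=
  Summable.of_norm (by simpa [abs_mul, abs_pow] using h.summable hz)

theorem gf_zero (a : ℕ → ℝ) : gf a 0 = a 0 := by
  rw [gf, tsum_eq_single 0]
  · simp
  · intro m hm; simp [hm]

theorem gf_const_mul (c : ℝ) (a : ℕ → ℝ) (z : ℝ) : gf (fun m => c * a m) z = c * gf a z := by
  simp only [gf, mul_assoc, tsum_mul_left]

theorem gf_add {a b : ℕ → ℝ} (ha : PolyBdd a) (hb : PolyBdd b) {z : ℝ} (hz : |z| < 1) :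
    gf (fun m => a m + b m) z = gf a z + gf b z := by
  simp only [gf, add_mul]
  exact (ha.summable_gf hz).tsum_add (hb.summable_gf hz)

theorem gf_eq_add_mul_shift {a : ℕ → ℝ} (ha : PolyBdd a) {z : ℝ} (hz : |z| < 1) :
    gf a z = a 0 + z * gf (fun m => a (m + 1)) z := by
  rw [gf, (ha.summable_gf hz).tsum_eq_zero_add, gf, ← tsum_mul_left]
  simp [pow_succ]
  congr 1; ext m; ring

/-- This is how the factor 1-z of the differential system appears on coefficients: multiplying by it
takes differences. -/
theorem gf_diffSeq {S : ℕ → ℝ} (h : PolyBdd S) {z : ℝ} (hz : |z| < 1) :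
    gf (diffSeq S) z = (1 - z) * gf S z := by
  have h1 := gf_eq_add_mul_shift h.diffSeq hz
  have h2 := gf_eq_add_mul_shift h hz
  have h3 : gf (fun m => diffSeq S (m + 1)) z = gf (fun m => S (m + 1)) z - gf S z := by
    have := gf_add h.shift (h.const_mul (-1)) hz
    rw [gf_const_mul] at this
    simpa [diffSeq, sub_eq_add_neg] using this
  rw [h1, h3]
  simp only [diffSeq]
  linear_combination (-1 : ℝ) * h2

theorem gf_nat_mul {a : ℕ → ℝ} (ha : PolyBdd a) {z : ℝ} (hz : |z| < 1) :
    gf (fun m => (m : ℝ) * a m) z = z * gf (fun m => ((m : ℝ) + 1) * a (m + 1)) z := by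
  rw [gf_eq_add_mul_shift ha.nat_mul hz]
  simp

theorem hasDerivAt_gf {a : ℕ → ℝ} (ha : PolyBdd a) {z : ℝ} (hz : |z| < 1) :
    HasDerivAt (gf a) (gf (fun m => ((m : ℝ) + 1) * a (m + 1)) z) z := by
  -- Termwise differentiation takes place on the ball of radius r, where the derivative series is
  -- dominated by its value at r < 1.
  obtain ⟨r, hzr, hr1⟩ := exists_between hz
  have hr0 : 0 < r := (abs_nonneg z).trans_lt hzr
  have hsum : Summable fun m : ℕ => |a m| * ((m : ℝ) * r ^ (m - 1)) := by
    have h1 : Summable fun m : ℕ => |((m : ℝ) + 1) * a (m + 1)| * |r| ^ m := by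
      refine PolyBdd.summable ?_ (by rwa [abs_of_pos hr0])
      simpa using ha.nat_mul.shift
    refine (summable_nat_add_iff 1).1 (h1.congr fun m => ?_)
    rw [abs_mul, abs_of_pos hr0, abs_of_nonneg (by positivity)]
    rw [Nat.add_sub_cancel]
    push_cast
    ring
  have key := hasDerivAt_tsum_of_isPreconnected (g := fun m y => a m * y ^ m)
    (g' := fun m y => a m * ((m : ℝ) * y ^ (m - 1))) (t := Metric.ball 0 r) (y₀ := 0) (y := z)
    hsum Metric.isOpen_ball (convex_ball _ _).isPreconnected
    (fun m y _ => (hasDerivAt_pow m y).const_mul (a m))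
    (fun m y hy => by
      have hy' : |y| ≤ r := by simpa using (Metric.mem_ball.1 hy).le
      rw [norm_mul, norm_mul, norm_pow, Real.norm_natCast, Real.norm_eq_abs, Real.norm_eq_abs]
      gcongr)
    (Metric.mem_ball_self hr0) (ha.summable_gf (by simp)) (by simpa using hzr)
  have hval : ∑' m : ℕ, a m * ((m : ℝ) * z ^ (m - 1))
      = gf (fun m => ((m : ℝ) + 1) * a (m + 1)) z := by
    have hs : Summable fun m : ℕ => a m * ((m : ℝ) * z ^ (m - 1)) := by
      refine Summable.of_norm_bounded hsum fun m => ?_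
      rw [norm_mul, norm_mul, norm_pow, Real.norm_natCast, Real.norm_eq_abs, Real.norm_eq_abs]
      gcongr
    rw [hs.tsum_eq_zero_add, gf]
    simp
    congr 1; ext m; ring
  rw [← hval]
  exact key

theorem hasDerivAt_gf_theta {a b : ℕ → ℝ} (ha : PolyBdd a) (hb : ∀ m : ℕ, b m = (m : ℝ) * a m)
    {z : ℝ} (hz : |z| < 1) (hz0 : z ≠ 0) : HasDerivAt (gf a) (z⁻¹ * gf b z) z := by
  have h := hasDerivAt_gf ha hz
  rw [show b = fun m : ℕ => (m : ℝ) * a m from funext hb, gf_nat_mul ha hz,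
    inv_mul_cancel_left₀ hz0]
  exact h

theorem hasDerivAt_gf_diff {a S : ℕ → ℝ} (ha : PolyBdd a) (hS : PolyBdd S)
    (h : ∀ m : ℕ, ((m : ℝ) + 1) * a (m + 1) = S m)
    {z : ℝ} (hz : |z| < 1) : HasDerivAt (gf a) ((1 - z)⁻¹ * gf (diffSeq S) z) z := by
  have h1 := hasDerivAt_gf ha hz
  rw [gf_diffSeq hS hz, inv_mul_cancel_left₀ (by linarith [(abs_lt.1 hz).2])]
  rwa [funext h] at h1

theorem tendsto_gf_zero {a : ℕ → ℝ} (ha : PolyBdd a) : Tendsto (gf a) (𝓝[>] 0) (𝓝 (a 0)) := by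
  have := (hasDerivAt_gf ha (z := 0) (by simp)).continuousAt.tendsto
  rw [gf_zero] at this
  exact this.mono_left nhdsWithin_le_nhds

/-- Abel's limit theorem, since the partial sums of the difference sequence are the terms of `S`. -/
theorem tendsto_gf_one {S : ℕ → ℝ} {l : ℝ} (h : Tendsto S atTop (𝓝 l)) :
    Tendsto (gf (diffSeq S)) (𝓝[<] 1) (𝓝 l) := by
  refine Real.tendsto_tsum_powerSeries_nhdsWithin_lt ((tendsto_add_atTop_iff_nat 1).1 ?_)
  simpa only [sum_range_succ_diffSeq] using h

theorem eq_of_hasDerivAt_zero {f : ℝ → ℝ} (h : ∀ z ∈ Set.Ioo (0 : ℝ) 1, HasDerivAt f 0 z)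
    {x y : ℝ} (hx : x ∈ Set.Ioo (0 : ℝ) 1) (hy : y ∈ Set.Ioo (0 : ℝ) 1) : f x = f y :=
  isOpen_Ioo.is_const_of_deriv_eq_zero isPreconnected_Ioo
    (fun z hz => (h z hz).differentiableAt.differentiableWithinAt) (fun z hz => (h z hz).deriv)
    hx hy

theorem eq_zero_of_hasDerivAt_zero {f : ℝ → ℝ} (h : ∀ z ∈ Set.Ioo (0 : ℝ) 1, HasDerivAt f 0 z)
    (h0 : Tendsto f (𝓝[>] 0) (𝓝 0)) {x : ℝ} (hx : x ∈ Set.Ioo (0 : ℝ) 1) : f x = 0 := by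
  refine tendsto_nhds_unique (tendsto_const_nhds.congr' ?_) h0
  filter_upwards [Ioo_mem_nhdsGT (zero_lt_one' ℝ)] with y hy
  exact eq_of_hasDerivAt_zero h hx hy

/-! ### Coefficientwise calculus and the differential system -/

/-- Coefficientwise derivative of a function with values in formal power series. -/
def HasCoeffDerivAt (f : ℝ → ℝ⟦X⟧) (f' : ℝ⟦X⟧) (z : ℝ) : Prop :=
  ∀ n, HasDerivAt (fun y => coeff n (f y)) (coeff n f') z

namespace HasCoeffDerivAt

variable {f g : ℝ → ℝ⟦X⟧} {f' g' : ℝ⟦X⟧} {z : ℝ}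

theorem const (c : ℝ⟦X⟧) (z : ℝ) : HasCoeffDerivAt (fun _ => c) 0 z := fun n => by
  simpa using hasDerivAt_const z (coeff n c)

theorem add (hf : HasCoeffDerivAt f f' z) (hg : HasCoeffDerivAt g g' z) :
    HasCoeffDerivAt (fun y => f y + g y) (f' + g') z := fun n => by
  simpa using (hf n).fun_add (hg n)

theorem neg (hf : HasCoeffDerivAt f f' z) : HasCoeffDerivAt (fun y => -f y) (-f') z := fun n => by
  simpa using (hf n).fun_neg

theorem sub (hf : HasCoeffDerivAt f f' z) (hg : HasCoeffDerivAt g g' z) :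
    HasCoeffDerivAt (fun y => f y - g y) (f' - g') z := fun n => by
  simpa using (hf n).fun_sub (hg n)

theorem mul (hf : HasCoeffDerivAt f f' z) (hg : HasCoeffDerivAt g g' z) :
    HasCoeffDerivAt (fun y => f y * g y) (f' * g z + f z * g') z := fun n => by
  simp only [map_add, coeff_mul, ← Finset.sum_add_distrib]
  exact HasDerivAt.fun_sum fun p _ => (hf p.1).mul (hg p.2)

theorem const_mul (c : ℝ⟦X⟧) (hf : HasCoeffDerivAt f f' z) :
    HasCoeffDerivAt (fun y => c * f y) (c * f') z := by
  simpa using (const c z).mul hf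

theorem scalar {h : ℝ → ℝ} {h' : ℝ} (hh : HasDerivAt h h' z) :
    HasCoeffDerivAt (fun y => C (h y)) (C h') z := fun n => by
  by_cases hn : n = 0
  · subst hn; simpa using hh
  · simpa [coeff_C, hn] using hasDerivAt_const z (0 : ℝ)

theorem evalNeg (hf : HasCoeffDerivAt f f' z) :
    HasCoeffDerivAt (fun y => evalNegHom (f y)) (evalNegHom f') z := fun n => by
  simpa [evalNegHom, coeff_rescale] using (hf n).const_mul ((-1) ^ n)

theorem one_sub (hf : HasCoeffDerivAt f f' (1 - z)) :
    HasCoeffDerivAt (fun y => f (1 - y)) (-f') z := fun n => by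
  have h1 : HasDerivAt (fun y : ℝ => 1 - y) (-1) z := by
    simpa using (hasDerivAt_id z).const_sub 1
  simpa [Function.comp_def] using (hf n).comp z h1

theorem eq_of_zero (h : ∀ z ∈ Set.Ioo (0 : ℝ) 1, HasCoeffDerivAt f 0 z)
    {x y : ℝ} (hx : x ∈ Set.Ioo (0 : ℝ) 1) (hy : y ∈ Set.Ioo (0 : ℝ) 1) : f x = f y := by
  ext n
  exact eq_of_hasDerivAt_zero (fun z hz => by simpa using h z hz n) hx hy

end HasCoeffDerivAt

theorem eq_of_tendsto_of_hasCoeffDerivAt_zero {f : ℝ → ℝ⟦X⟧} {l : Filter ℝ} [l.NeBot] {c : ℝ⟦X⟧}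
    (h : ∀ z ∈ Set.Ioo (0 : ℝ) 1, HasCoeffDerivAt f 0 z) (hl : Set.Ioo (0 : ℝ) 1 ∈ l)
    (h0 : Tendsto f l (𝓝 c)) {x : ℝ} (hx : x ∈ Set.Ioo (0 : ℝ) 1) : f x = c := by
  refine tendsto_nhds_unique (tendsto_const_nhds.congr' ?_) h0
  filter_upwards [hl] with y hy
  exact HasCoeffDerivAt.eq_of_zero h hx hy

theorem tendsto_evalNegHom {α : Type*} {l : Filter α} {f : α → ℝ⟦X⟧} {c : ℝ⟦X⟧}
    (h : Tendsto f l (𝓝 c)) : Tendsto (fun y => evalNegHom (f y)) l (𝓝 (evalNegHom c)) := by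
  rw [WithPiTopology.tendsto_iff_coeff_tendsto] at *
  intro n
  simpa [evalNegHom, coeff_rescale] using (h n).const_mul ((-1) ^ n)

theorem evalNegHom_evalNegHom (f : ℝ⟦X⟧) : evalNegHom (evalNegHom f) = f := by
  ext n
  simp [evalNegHom, coeff_rescale, ← mul_assoc, ← mul_pow]

theorem evalNegHom_C (c : ℝ) : evalNegHom (C c : ℝ⟦X⟧) = C c := by
  ext n
  by_cases hn : n = 0 <;> simp [evalNegHom, coeff_rescale, coeff_C, hn]

/-- `(y, q)` solves `z y' = q`, `(1 - z) q' = l y` on the unit interval. -/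
def IsSolution (l : ℝ⟦X⟧) (y q : ℝ → ℝ⟦X⟧) : Prop :=
  ∀ z ∈ Set.Ioo (0 : ℝ) 1, HasCoeffDerivAt y (C z⁻¹ * q z) z ∧
    HasCoeffDerivAt q (C (1 - z)⁻¹ * (l * y z)) z

namespace IsSolution

variable {l : ℝ⟦X⟧} {y q y' q' : ℝ → ℝ⟦X⟧}

/-- The substitution z ↦ 1-z exchanges the two weights z and 1-z, hence the roles of y and q. This
symmetry is what links the endpoints 0 and 1. -/
theorem reflect (h : IsSolution l y q) :
    IsSolution l (fun z => q (1 - z)) (fun z => -(l * y (1 - z))) := by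
  intro z hz
  have hz' : 1 - z ∈ Set.Ioo (0 : ℝ) 1 := ⟨by linarith [hz.2], by linarith [hz.1]⟩
  obtain ⟨h1, h2⟩ := h _ hz'
  refine ⟨?_, ?_⟩
  · convert h2.one_sub using 1
    rw [sub_sub_cancel]
    ring
  · convert (h1.one_sub.const_mul l).neg using 1
    ring

theorem evalNeg (h : IsSolution l y q) :
    IsSolution (evalNegHom l) (fun z => evalNegHom (y z)) (fun z => evalNegHom (q z)) := by
  intro z hz
  obtain ⟨h1, h2⟩ := h z hz
  exact ⟨by simpa [evalNegHom_C] using h1.evalNeg, by simpa [evalNegHom_C] using h2.evalNeg⟩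

/-- The coefficient matrix of the first-order system has trace zero. -/
theorem wronskian (h : IsSolution l y q) (h' : IsSolution l y' q') {z : ℝ}
    (hz : z ∈ Set.Ioo (0 : ℝ) 1) : HasCoeffDerivAt (fun z => y z * q' z - y' z * q z) 0 z := by
  obtain ⟨h1, h2⟩ := h z hz
  obtain ⟨h3, h4⟩ := h' z hz
  convert (h1.mul h4).sub (h3.mul h2) using 1
  ring

variable {l₁ l₂ : ℝ⟦X⟧} {y₁ q₁ y₂ q₂ : ℝ → ℝ⟦X⟧}

/-- First of four differentiations, with weights z, z, 1-z, 1-z, that return to y₁ y₂ with the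
factor -4l² when the parameters are opposite. -/
theorem deriv_mul (h₁ : IsSolution l₁ y₁ q₁) (h₂ : IsSolution l₂ y₂ q₂) {z : ℝ}
    (hz : z ∈ Set.Ioo (0 : ℝ) 1) :
    HasCoeffDerivAt (fun z => y₁ z * y₂ z) (C z⁻¹ * (q₁ z * y₂ z + y₁ z * q₂ z)) z := by
  convert (h₁ z hz).1.mul (h₂ z hz).1 using 1
  ring

/-- Opposite parameters make the two contributions ± l y₁ y₂ / (1-z) cancel. -/
theorem deriv_sym (h₁ : IsSolution l y₁ q₁) (h₂ : IsSolution (-l) y₂ q₂) {z : ℝ}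
    (hz : z ∈ Set.Ioo (0 : ℝ) 1) :
    HasCoeffDerivAt (fun z => q₁ z * y₂ z + y₁ z * q₂ z) (C z⁻¹ * (2 * (q₁ z * q₂ z))) z := by
  obtain ⟨h1, h2⟩ := h₁ z hz
  obtain ⟨h3, h4⟩ := h₂ z hz
  convert (h2.mul h3).add (h1.mul h4) using 1
  ring

theorem deriv_two_mul (h₁ : IsSolution l y₁ q₁) (h₂ : IsSolution (-l) y₂ q₂) {z : ℝ}
    (hz : z ∈ Set.Ioo (0 : ℝ) 1) :
    HasCoeffDerivAt (fun z => 2 * (q₁ z * q₂ z))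
      (C (1 - z)⁻¹ * (2 * l * (y₁ z * q₂ z - q₁ z * y₂ z))) z := by
  obtain ⟨h1, h2⟩ := h₁ z hz
  obtain ⟨h3, h4⟩ := h₂ z hz
  convert (h2.mul h4).const_mul 2 using 1
  ring

/-- Here the two q₁ q₂ / z terms cancel, while the l y₁ y₂ / (1-z) terms add up and close the cycle.
-/
theorem deriv_anti (h₁ : IsSolution l y₁ q₁) (h₂ : IsSolution (-l) y₂ q₂) {z : ℝ}
    (hz : z ∈ Set.Ioo (0 : ℝ) 1) :
    HasCoeffDerivAt (fun z => 2 * l * (y₁ z * q₂ z - q₁ z * y₂ z))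
      (C (1 - z)⁻¹ * (-4 * l ^ 2 * (y₁ z * y₂ z))) z := by
  obtain ⟨h1, h2⟩ := h₁ z hz
  obtain ⟨h3, h4⟩ := h₂ z hz
  convert ((h1.mul h4).sub (h2.mul h3)).const_mul (2 * l) using 1
  ring

end IsSolution

/-! ### Generating functions with power series coefficients and their endpoint limits -/

/-- Coefficientwise polynomial growth. -/
def CoeffPolyBdd (a : ℕ → ℝ⟦X⟧) : Prop := ∀ n, PolyBdd fun m => coeff n (a m)

/-- The coefficientwise generating function `∑ aₘ zᵐ` of a sequence of formal power series. -/
noncomputable def coeffGf (a : ℕ → ℝ⟦X⟧) (z : ℝ) : ℝ⟦X⟧ := mk fun n => gf (fun m => coeff n (a m)) z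

theorem coeff_diffSeq (a : ℕ → ℝ⟦X⟧) (n : ℕ) :
    (fun m => coeff n (diffSeq a m)) = diffSeq fun m => coeff n (a m) := by
  funext m
  cases m <;> simp [diffSeq]

theorem CoeffPolyBdd.of_tendsto {a : ℕ → ℝ⟦X⟧} {l : ℝ⟦X⟧} (h : Tendsto a atTop (𝓝 l)) :
    CoeffPolyBdd a :=
  fun n => PolyBdd.of_tendsto ((WithPiTopology.tendsto_iff_coeff_tendsto ..).1 h n)

theorem CoeffPolyBdd.diffSeq {a : ℕ → ℝ⟦X⟧} (h : CoeffPolyBdd a) : CoeffPolyBdd (diffSeq a) :=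
  fun n => by rw [coeff_diffSeq]; exact (h n).diffSeq

theorem CoeffPolyBdd.nat_mul {a : ℕ → ℝ⟦X⟧} (h : CoeffPolyBdd a) :
    CoeffPolyBdd fun m => C (m : ℝ) * a m :=
  fun n => by simpa only [coeff_C_mul] using (h n).nat_mul

theorem CoeffPolyBdd.add {a b : ℕ → ℝ⟦X⟧} (ha : CoeffPolyBdd a) (hb : CoeffPolyBdd b) :
    CoeffPolyBdd fun m => a m + b m :=
  fun n => by simpa using (ha n).add (hb n)

theorem CoeffPolyBdd.scalar_mul {a : ℕ → ℝ⟦X⟧} (h : CoeffPolyBdd a) (c : ℝ) :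
    CoeffPolyBdd fun m => C c * a m :=
  fun n => by simpa using (h n).const_mul c

theorem CoeffPolyBdd.shift {a : ℕ → ℝ⟦X⟧} (h : CoeffPolyBdd a) :
    CoeffPolyBdd fun m => a (m + 1) :=
  fun n => (h n).shift

theorem CoeffPolyBdd.X_mul {a : ℕ → ℝ⟦X⟧} (h : CoeffPolyBdd a) : CoeffPolyBdd fun m => X * a m := by
  intro n
  cases n with
  | zero => exact ⟨0, 0, by simp⟩
  | succ n => simpa [coeff_succ_X_mul] using h n

theorem coeffGf_X_mul (a : ℕ → ℝ⟦X⟧) (z : ℝ) :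
    coeffGf (diffSeq fun m => X * a m) z = X * coeffGf (diffSeq a) z := by
  have h : (diffSeq fun m => X * a m) = fun m => X * diffSeq a m := by
    funext m; cases m <;> simp [diffSeq, mul_sub]
  ext n
  cases n with
  | zero => simp [coeffGf, h, gf]
  | succ n => simp [coeffGf, coeff_succ_X_mul, h]

theorem coeffGf_add {a b : ℕ → ℝ⟦X⟧} (ha : CoeffPolyBdd a) (hb : CoeffPolyBdd b) {z : ℝ}
    (hz : |z| < 1) : coeffGf (fun m => a m + b m) z = coeffGf a z + coeffGf b z := by
  ext n
  simpa [coeffGf] using gf_add (ha n) (hb n) hz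

theorem coeffGf_scalar_mul (c : ℝ) (a : ℕ → ℝ⟦X⟧) (z : ℝ) :
    coeffGf (fun m => C c * a m) z = C c * coeffGf a z := by
  ext n
  simp [coeffGf, gf_const_mul]

theorem coeffGf_eq_mul_shift {a : ℕ → ℝ⟦X⟧} (ha : CoeffPolyBdd a) (h0 : a 0 = 0) {z : ℝ}
    (hz : |z| < 1) : coeffGf a z = C z * coeffGf (fun m => a (m + 1)) z := by
  ext n
  simpa [coeffGf, h0] using gf_eq_add_mul_shift (ha n) hz

theorem coeffGf_diffSeq {a : ℕ → ℝ⟦X⟧} (ha : CoeffPolyBdd a) {z : ℝ} (hz : |z| < 1) :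
    coeffGf (diffSeq a) z = C (1 - z) * coeffGf a z := by
  ext n
  rw [coeff_C_mul]
  simp only [coeffGf, coeff_mk, coeff_diffSeq]
  exact gf_diffSeq (ha n) hz

theorem hasCoeffDerivAt_coeffGf_theta {a : ℕ → ℝ⟦X⟧} (ha : CoeffPolyBdd a) {z : ℝ}
    (hz : |z| < 1) (hz0 : z ≠ 0) :
    HasCoeffDerivAt (coeffGf a) (C z⁻¹ * coeffGf (fun m => C (m : ℝ) * a m) z) z := by
  intro n
  simp only [coeffGf, coeff_C_mul, coeff_mk]
  exact hasDerivAt_gf_theta (ha n) (fun m => rfl) hz hz0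

theorem hasCoeffDerivAt_coeffGf_diff {a S : ℕ → ℝ⟦X⟧} (ha : CoeffPolyBdd a) (hS : CoeffPolyBdd S)
    (h : ∀ m : ℕ, C ((m : ℝ) + 1) * a (m + 1) = S m) {z : ℝ} (hz : |z| < 1) :
    HasCoeffDerivAt (coeffGf a) (C (1 - z)⁻¹ * coeffGf (diffSeq S) z) z := by
  intro n
  rw [coeff_C_mul]
  simp only [coeffGf, coeff_mk, coeff_diffSeq]
  exact hasDerivAt_gf_diff (ha n) (hS n) (fun m => by rw [← h, coeff_C_mul]) hz

theorem tendsto_coeffGf_zero {a : ℕ → ℝ⟦X⟧} (ha : CoeffPolyBdd a) :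
    Tendsto (coeffGf a) (𝓝[>] 0) (𝓝 (a 0)) := by
  rw [WithPiTopology.tendsto_iff_coeff_tendsto]
  intro n
  simpa [coeffGf] using tendsto_gf_zero (ha n)

theorem tendsto_coeffGf_one {S : ℕ → ℝ⟦X⟧} {l : ℝ⟦X⟧} (h : Tendsto S atTop (𝓝 l)) :
    Tendsto (coeffGf (diffSeq S)) (𝓝[<] 1) (𝓝 l) := by
  rw [WithPiTopology.tendsto_iff_coeff_tendsto] at *
  intro n
  simp only [coeffGf, coeff_mk, coeff_diffSeq]
  exact tendsto_gf_one (h n)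

theorem tendsto_C {α : Type*} {l : Filter α} {f : α → ℝ} {c : ℝ} (h : Tendsto f l (𝓝 c)) :
    Tendsto (fun y => (C (f y) : ℝ⟦X⟧)) l (𝓝 (C c)) :=
  ((WithPiTopology.continuous_C (R := ℝ)).tendsto c).comp h

theorem eventually_abs_lt_one_zero : ∀ᶠ z : ℝ in 𝓝[>] 0, |z| < 1 := by
  filter_upwards [Ioo_mem_nhdsGT (zero_lt_one' ℝ)] with y hy
  rw [abs_of_pos hy.1]; exact hy.2

theorem eventually_abs_lt_one_one : ∀ᶠ z : ℝ in 𝓝[<] 1, |z| < 1 := by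
  filter_upwards [Ioo_mem_nhdsLT (zero_lt_one' ℝ)] with y hy
  rw [abs_of_pos hy.1]; exact hy.2

theorem tendsto_log_pow_mul_self (k : ℕ) :
    Tendsto (fun z : ℝ => Real.log z ^ k * z) (𝓝[>] 0) (𝓝 0) := by
  cases k with
  | zero =>
    simp only [pow_zero, one_mul]
    exact tendsto_id.mono_left nhdsWithin_le_nhds
  | succ k =>
    have h := (tendsto_log_mul_rpow_nhdsGT_zero
      (r := ((k + 1 : ℕ) : ℝ)⁻¹) (by positivity)).pow (k + 1)
    rw [zero_pow (Nat.succ_ne_zero k)] at h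
    refine h.congr' ?_
    filter_upwards [self_mem_nhdsWithin] with z hz
    rw [mul_pow, ← Real.rpow_natCast (z ^ _), ← Real.rpow_mul (le_of_lt hz),
      inv_mul_cancel₀ (by positivity), Real.rpow_one]

/-- A vanishing constant term supplies a factor z, which beats every power of log z. -/
theorem tendsto_log_pow_mul_coeffGf {a : ℕ → ℝ⟦X⟧} (ha : CoeffPolyBdd a) (h0 : a 0 = 0) (k : ℕ) :
    Tendsto (fun z => C (Real.log z ^ k) * coeffGf a z) (𝓝[>] 0) (𝓝 0) := by
  have h := (tendsto_C (tendsto_log_pow_mul_self k)).mul (tendsto_coeffGf_zero ha.shift)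
  rw [map_zero, zero_mul] at h
  refine h.congr' ?_
  filter_upwards [eventually_abs_lt_one_zero] with z hz
  rw [coeffGf_eq_mul_shift ha h0 hz, map_mul, mul_assoc]

/-- The relation makes a(m) of order 1/m, so a(m) → 0. Multiplying by 1-z takes differences, and
Abel's theorem gives the limit of a(m), bounding the singularity at 1. -/
theorem tendsto_one_sub_mul_coeffGf {a S : ℕ → ℝ⟦X⟧} {l : ℝ⟦X⟧} (ha : CoeffPolyBdd a)
    (hS : Tendsto S atTop (𝓝 l)) (h : ∀ m : ℕ, C ((m : ℝ) + 1) * a (m + 1) = S m) :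
    Tendsto (fun z => C (1 - z) * coeffGf a z) (𝓝[<] 1) (𝓝 0) := by
  have h1 : Tendsto a atTop (𝓝 0) := by
    refine (tendsto_add_atTop_iff_nat 1).1 ?_
    have h2 := (tendsto_C (tendsto_one_div_add_atTop_nhds_zero_nat (𝕜 := ℝ))).mul hS
    rw [map_zero, zero_mul] at h2
    refine h2.congr fun m => ?_
    have h3 : 1 / ((m : ℝ) + 1) * ((m : ℝ) + 1) = 1 := one_div_mul_cancel (by positivity)
    rw [← h, ← mul_assoc, ← map_mul, h3, map_one, one_mul]
  refine (tendsto_coeffGf_one h1).congr' ?_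
  filter_upwards [eventually_abs_lt_one_one] with z hz
  exact coeffGf_diffSeq ha hz

/-! ### The infinite product and the zeta series -/

/-- The partial products of `∏ (1 + X / k²)`. -/
noncomputable def sineProd (m : ℕ) : ℝ⟦X⟧ :=
  ∏ k ∈ Finset.range m, (1 + C ((((k + 1 : ℕ) : ℝ)) ^ 2)⁻¹ * X)

/-- The limit of `sineProd`. -/
noncomputable def sineSeries : ℝ⟦X⟧ := mk fun n => mzv (stringPow [2] n)

theorem sineProd_succ (m : ℕ) :
    sineProd (m + 1) = sineProd m * (1 + C ((((m + 1 : ℕ) : ℝ)) ^ 2)⁻¹ * X) :=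
  Finset.prod_range_succ _ _

theorem mzvPartial_cons_succ (a : ℕ) (s : List ℕ) (m : ℕ) :
    mzvPartial (a :: s) (m + 1)
      = mzvPartial (a :: s) m + (((m + 1 : ℕ) : ℝ) ^ a)⁻¹ * mzvPartial s m :=
  Finset.sum_range_succ _ _

theorem coeff_sineProd (n m : ℕ) : coeff n (sineProd m) = mzvPartial (stringPow [2] n) m := by
  induction m generalizing n with
  | zero =>
    cases n with
    | zero => simp [sineProd, stringPow_zero, mzvPartial]
    | succ n => simp [sineProd, stringPow_succ, mzvPartial, coeff_one]
  | succ m ih =>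
    rw [sineProd_succ, mul_add, mul_one, map_add, ih, ← mul_assoc]
    cases n with
    | zero => simp [stringPow_zero, mzvPartial]
    | succ n =>
      rw [coeff_succ_mul_X, mul_comm, coeff_C_mul, ih, stringPow_succ, List.singleton_append,
        mzvPartial_cons_succ]

theorem tendsto_sineProd : Tendsto sineProd atTop (𝓝 sineSeries) := by
  rw [WithPiTopology.tendsto_iff_coeff_tendsto]
  intro n
  simpa only [coeff_sineProd, sineSeries, coeff_mk]
    using tendsto_mzvPartial_stringPow_singleton le_rfl n

/-- The partial sums of `∑ₖ k⁻ᵉ X / (k² + X) = -∑_{j ≥ 1} ζ(2j + e) (-X)ʲ`. -/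
noncomputable def zetaPartial (e m : ℕ) : ℝ⟦X⟧ :=
  mk fun j => if j = 0 then 0 else -((-1) ^ j * mzvPartial [2 * j + e] m)

/-- The power series `-∑_{j ≥ 1} ζ(2j + e) (-X)ʲ`. -/
noncomputable def zetaSeries (e : ℕ) : ℝ⟦X⟧ :=
  mk fun j => if j = 0 then 0 else -((-1) ^ j * mzv [2 * j + e])

theorem tendsto_zetaPartial (e : ℕ) : Tendsto (zetaPartial e) atTop (𝓝 (zetaSeries e)) := by
  rw [WithPiTopology.tendsto_iff_coeff_tendsto]
  intro n
  by_cases hn : n = 0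
  · simp [zetaPartial, zetaSeries, hn]
  · simp only [zetaPartial, zetaSeries, coeff_mk, hn, if_false]
    exact ((tendsto_mzvPartial (by omega) (by simp)).const_mul _).neg

/-- The increment is the geometric series of k⁻ᵉ X/(k² + X) with k = m+1, and 1 + X/k² clears its
denominator. -/
theorem zetaPartial_succ_sub (e m : ℕ) :
    (1 + C ((((m + 1 : ℕ) : ℝ)) ^ 2)⁻¹ * X) * (zetaPartial e (m + 1) - zetaPartial e m)
      = C ((((m + 1 : ℕ) : ℝ)) ^ (2 + e))⁻¹ * X := by
  have hd : ∀ j, coeff (j + 1) (zetaPartial e (m + 1) - zetaPartial e m)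
      = (-1) ^ j * ((((m + 1 : ℕ) : ℝ)) ^ (2 * (j + 1) + e))⁻¹ := by
    intro j
    simp only [zetaPartial, map_sub, coeff_mk, mzvPartial_cons_succ]
    simp only [mzvPartial, Nat.succ_ne_zero, if_false, mul_one, pow_succ]
    ring
  have hd0 : coeff 0 (zetaPartial e (m + 1) - zetaPartial e m) = 0 := by simp [zetaPartial]
  ext n
  rw [add_mul, one_mul, map_add, mul_assoc, coeff_C_mul, coeff_C_mul]
  cases n with
  | zero => rw [hd0]; simp
  | succ n =>
    rw [coeff_succ_X_mul, hd]
    cases n with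
    | zero => rw [hd0]; simp
    | succ n =>
      rw [hd, coeff_X, if_neg (by omega), mul_zero]
      have : ((m + 1 : ℕ) : ℝ) ≠ 0 := by positivity
      field_simp
      ring

/-! ### The two solutions at the origin -/

/-- The coefficients of the logarithmic solution, before taking differences. -/
noncomputable def logCoeff (m : ℕ) : ℝ⟦X⟧ := C (-2) * (sineProd m * zetaPartial 1 m)

theorem tendsto_logCoeff :
    Tendsto logCoeff atTop (𝓝 (C (-2) * (sineSeries * zetaSeries 1))) :=
  tendsto_const_nhds.mul (tendsto_sineProd.mul (tendsto_zetaPartial 1))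

/-- The solution `∑ ζ_z({2}ⁿ) Xⁿ` regular at `0`. -/
noncomputable def regSol : ℝ → ℝ⟦X⟧ := coeffGf (diffSeq sineProd)

/-- `z d/dz` of `regSol`. -/
noncomputable def regSolTheta : ℝ → ℝ⟦X⟧ := coeffGf fun m => C (m : ℝ) * diffSeq sineProd m

/-- The power series part of the logarithmic solution. -/
noncomputable def logPart : ℝ → ℝ⟦X⟧ := coeffGf (diffSeq logCoeff)

/-- `z d/dz logPart + 2 regSol`. -/
noncomputable def logAux : ℝ → ℝ⟦X⟧ :=
  coeffGf fun m => C (m : ℝ) * diffSeq logCoeff m + C 2 * diffSeq sineProd m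

/-- The logarithmic solution. -/
noncomputable def logSol (z : ℝ) : ℝ⟦X⟧ := C (Real.log z) * regSol z + logPart z

/-- `z d/dz` of `logSol`. -/
noncomputable def logSolTheta (z : ℝ) : ℝ⟦X⟧ :=
  C (Real.log z) * regSolTheta z + logAux z - regSol z

theorem coeffPolyBdd_sineProd : CoeffPolyBdd sineProd := .of_tendsto tendsto_sineProd

theorem coeffPolyBdd_logCoeff : CoeffPolyBdd logCoeff := .of_tendsto tendsto_logCoeff

theorem regSol_recurrence (m : ℕ) :
    C ((m : ℝ) + 1) * (C ((m + 1 : ℕ) : ℝ) * diffSeq sineProd (m + 1)) = X * sineProd m := by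
  have h : C ((m + 1 : ℕ) : ℝ) * (C ((m + 1 : ℕ) : ℝ) * C ((((m + 1 : ℕ) : ℝ)) ^ 2)⁻¹)
      = (1 : ℝ⟦X⟧) := by
    rw [← map_mul, ← map_mul, ← map_one (C (R := ℝ))]
    congr 1
    have : ((m + 1 : ℕ) : ℝ) ≠ 0 := by positivity
    field_simp
  have h' : ((m : ℝ) + 1) = ((m + 1 : ℕ) : ℝ) := by push_cast; rfl
  rw [diffSeq, sineProd_succ, h']
  linear_combination X * sineProd m * h

/-- Frobenius' method explains the shape of `logCoeff`: it is the derivative at ρ = 0 of ∏ (1 +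
X/(k+ρ)²), whose logarithmic derivative there is -2 ∑ X/(k(k² + X)). -/
theorem logSol_recurrence (m : ℕ) :
    C ((m : ℝ) + 1) * (C ((m + 1 : ℕ) : ℝ) * diffSeq logCoeff (m + 1)
      + C 2 * diffSeq sineProd (m + 1)) = X * logCoeff m := by
  have hk : ((m + 1 : ℕ) : ℝ) ≠ 0 := by positivity
  have h' : ((m : ℝ) + 1) = ((m + 1 : ℕ) : ℝ) := by push_cast; rfl
  have hz := zetaPartial_succ_sub 1 m
  rw [diffSeq, diffSeq, logCoeff, logCoeff, sineProd_succ, h']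
  generalize ((m + 1 : ℕ) : ℝ) = k at *
  have h2 : C k * (C k * C (k ^ 2)⁻¹) = (1 : ℝ⟦X⟧) := by
    rw [← map_mul, ← map_mul, ← map_one (C (R := ℝ))]
    congr 1
    field_simp
  have h3 : C k * C (k ^ (2 + 1))⁻¹ = (C (k ^ 2)⁻¹ : ℝ⟦X⟧) := by
    rw [← map_mul]
    congr 1
    field_simp
  have h4 : (C (-2) : ℝ⟦X⟧) = -C 2 := by rw [map_neg]
  rw [h4]
  linear_combination (-C 2 * C k ^ 2 * sineProd m) * hz
    + (-C 2 * X * sineProd m * zetaPartial 1 m) * h2 - C 2 * C k * sineProd m * X * h3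

theorem isSolution_regSol : IsSolution X regSol regSolTheta := by
  intro z hz
  have hz1 : |z| < 1 := by rw [abs_of_pos hz.1]; exact hz.2
  refine ⟨hasCoeffDerivAt_coeffGf_theta coeffPolyBdd_sineProd.diffSeq hz1 hz.1.ne', ?_⟩
  rw [regSol, ← coeffGf_X_mul]
  exact hasCoeffDerivAt_coeffGf_diff coeffPolyBdd_sineProd.diffSeq.nat_mul
    coeffPolyBdd_sineProd.X_mul regSol_recurrence hz1

theorem logAux_eq {z : ℝ} (hz : |z| < 1) :
    logAux z = coeffGf (fun m => C (m : ℝ) * diffSeq logCoeff m) z + C 2 * regSol z := by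
  rw [logAux, coeffGf_add coeffPolyBdd_logCoeff.diffSeq.nat_mul
    (coeffPolyBdd_sineProd.diffSeq.scalar_mul 2) hz, coeffGf_scalar_mul, regSol]

theorem coeffPolyBdd_logAux :
    CoeffPolyBdd fun m : ℕ => C (m : ℝ) * diffSeq logCoeff m + C 2 * diffSeq sineProd m :=
  coeffPolyBdd_logCoeff.diffSeq.nat_mul.add (coeffPolyBdd_sineProd.diffSeq.scalar_mul 2)

/-- Differentiating log z in `logSolTheta` produces the extra term z⁻¹ `regSolTheta`, which is the
derivative of `regSol`. The subtracted `regSol` cancels it, and this accounts for the 2 in `logAux`.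
-/
theorem isSolution_logSol : IsSolution X logSol logSolTheta := by
  intro z hz
  have hz1 : |z| < 1 := by rw [abs_of_pos hz.1]; exact hz.2
  obtain ⟨hu, hq⟩ := isSolution_regSol z hz
  have hlog := HasCoeffDerivAt.scalar (Real.hasDerivAt_log hz.1.ne')
  have hw : HasCoeffDerivAt logPart _ z :=
    hasCoeffDerivAt_coeffGf_theta coeffPolyBdd_logCoeff.diffSeq hz1 hz.1.ne'
  have hs : HasCoeffDerivAt logAux _ z := hasCoeffDerivAt_coeffGf_diff coeffPolyBdd_logAux
    coeffPolyBdd_logCoeff.X_mul logSol_recurrence hz1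
  rw [coeffGf_X_mul] at hs
  have h2 : (C 2 : ℝ⟦X⟧) = 2 := map_ofNat _ 2
  refine ⟨?_, ?_⟩
  · have hv : HasCoeffDerivAt logSol _ z := (hlog.mul hu).add hw
    convert hv using 1
    rw [logSolTheta, logAux_eq hz1, h2]
    ring
  · have hp : HasCoeffDerivAt logSolTheta _ z := ((hlog.mul hq).add hs).sub hu
    convert hp using 1
    rw [logSol, logPart]
    ring

theorem tendsto_regSol_zero : Tendsto regSol (𝓝[>] 0) (𝓝 1) := by
  have h : diffSeq sineProd 0 = 1 := by simp [diffSeq, sineProd]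
  rw [← h]
  exact tendsto_coeffGf_zero coeffPolyBdd_sineProd.diffSeq

theorem tendsto_log_pow_mul_regSolTheta (k : ℕ) :
    Tendsto (fun z => C (Real.log z ^ k) * regSolTheta z) (𝓝[>] 0) (𝓝 0) :=
  tendsto_log_pow_mul_coeffGf coeffPolyBdd_sineProd.diffSeq.nat_mul (by simp) k

theorem tendsto_regSolTheta_zero : Tendsto regSolTheta (𝓝[>] 0) (𝓝 0) := by
  simpa using tendsto_log_pow_mul_regSolTheta 0

theorem diffSeq_logCoeff_zero : diffSeq logCoeff 0 = 0 := by
  have : zetaPartial 1 0 = 0 := by ext n; simp [zetaPartial, mzvPartial]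
  simp [diffSeq, logCoeff, this]

theorem tendsto_log_pow_mul_logPart (k : ℕ) :
    Tendsto (fun z => C (Real.log z ^ k) * logPart z) (𝓝[>] 0) (𝓝 0) :=
  tendsto_log_pow_mul_coeffGf coeffPolyBdd_logCoeff.diffSeq diffSeq_logCoeff_zero k

theorem tendsto_logPart_zero : Tendsto logPart (𝓝[>] 0) (𝓝 0) := by
  simpa using tendsto_log_pow_mul_logPart 0

theorem tendsto_log_mul_logAux :
    Tendsto (fun z => C (Real.log z) * (logAux z - C 2 * regSol z)) (𝓝[>] 0) (𝓝 0) := by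
  have h := tendsto_log_pow_mul_coeffGf coeffPolyBdd_logCoeff.diffSeq.nat_mul (by simp) 1
  refine h.congr' ?_
  filter_upwards [eventually_abs_lt_one_zero] with z hz
  rw [logAux_eq hz, add_sub_cancel_right, pow_one]

theorem tendsto_logAux_zero : Tendsto logAux (𝓝[>] 0) (𝓝 2) := by
  have h : C ((0 : ℕ) : ℝ) * diffSeq logCoeff 0 + C 2 * diffSeq sineProd 0 = 2 := by
    rw [diffSeq_logCoeff_zero, mul_zero, zero_add, diffSeq, sineProd, Finset.prod_range_zero,
      mul_one]
    exact map_ofNat _ 2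
  rw [← h]
  exact tendsto_coeffGf_zero coeffPolyBdd_logAux

theorem tendsto_logSolTheta_zero : Tendsto logSolTheta (𝓝[>] 0) (𝓝 1) := by
  have := ((tendsto_log_pow_mul_regSolTheta 1).add tendsto_logAux_zero).sub tendsto_regSol_zero
  rw [zero_add, show (2 : ℝ⟦X⟧) - 1 = 1 by ring] at this
  refine this.congr fun z => ?_
  rw [pow_one, logSolTheta]

theorem tendsto_regSol_one : Tendsto regSol (𝓝[<] 1) (𝓝 sineSeries) :=
  tendsto_coeffGf_one tendsto_sineProd

theorem tendsto_log_one : Tendsto Real.log (𝓝[<] 1) (𝓝 0) := by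
  have := (Real.continuousAt_log (one_ne_zero (α := ℝ))).tendsto
  rw [Real.log_one] at this
  exact this.mono_left nhdsWithin_le_nhds

theorem tendsto_logSol_one :
    Tendsto logSol (𝓝[<] 1) (𝓝 (C (-2) * (sineSeries * zetaSeries 1))) := by
  have := ((tendsto_C tendsto_log_one).mul tendsto_regSol_one).add
    (tendsto_coeffGf_one tendsto_logCoeff)
  rw [map_zero, zero_mul, zero_add] at this
  exact this

theorem tendsto_one_sub_mul_logSolTheta :
    Tendsto (fun z => C (1 - z) * logSolTheta z) (𝓝[<] 1) (𝓝 0) := by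
  have hX : Tendsto (fun m => X * sineProd m) atTop (𝓝 (X * sineSeries)) :=
    tendsto_const_nhds.mul tendsto_sineProd
  have hX' : Tendsto (fun m => X * logCoeff m) atTop (𝓝 (X * _)) :=
    tendsto_const_nhds.mul tendsto_logCoeff
  have h1 := tendsto_one_sub_mul_coeffGf coeffPolyBdd_sineProd.diffSeq.nat_mul hX
    regSol_recurrence
  have h2 := tendsto_one_sub_mul_coeffGf coeffPolyBdd_logAux hX' logSol_recurrence
  have h3 : Tendsto (fun z : ℝ => 1 - z) (𝓝[<] 1) (𝓝 0) := by
    have : Tendsto (fun z : ℝ => 1 - z) (𝓝 1) (𝓝 (1 - 1)) := by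
      exact (continuous_const.sub continuous_id).tendsto 1
    rw [sub_self] at this
    exact this.mono_left nhdsWithin_le_nhds
  have := (((tendsto_C tendsto_log_one).mul h1).add h2).sub ((tendsto_C h3).mul tendsto_regSol_one)
  simp only [map_zero, mul_zero, zero_mul, add_zero, sub_zero] at this
  refine this.congr fun z => ?_
  rw [logSolTheta, regSolTheta, logAux]
  ring

/-! ### Polylogarithms and the antisymmetrized product -/

/-- The multiple polylogarithm of one variable with arguments `s`. -/
noncomputable def polylog (s : List ℕ) : ℝ → ℝ := gf (diffSeq (mzvPartial s))

theorem polyBdd_mzvPartial {s : List ℕ} (hs : ∀ a ∈ s, 1 ≤ a) : PolyBdd (mzvPartial s) :=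
  ⟨1, s.length, fun m => by
    rw [abs_of_nonneg (mzvPartial_nonneg _ _), one_mul]; exact mzvPartial_le_pow hs m⟩

theorem diffSeq_mzvPartial_succ (a : ℕ) (s : List ℕ) (m : ℕ) :
    diffSeq (mzvPartial (a :: s)) (m + 1) = (((m + 1 : ℕ) : ℝ) ^ a)⁻¹ * mzvPartial s m := by
  rw [diffSeq, mzvPartial_cons_succ, add_sub_cancel_left]

theorem diffSeq_mzvPartial_zero (a : ℕ) (s : List ℕ) : diffSeq (mzvPartial (a :: s)) 0 = 0 := by
  simp [diffSeq, mzvPartial]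

theorem polylog_nil (z : ℝ) : polylog [] z = 1 := by
  rw [polylog, gf, tsum_eq_single 0]
  · simp [diffSeq, mzvPartial]
  · intro m hm
    obtain ⟨k, rfl⟩ := Nat.exists_eq_succ_of_ne_zero hm
    simp [diffSeq, mzvPartial]

theorem hasDerivAt_polylog_succ {a : ℕ} {s : List ℕ} (hs : ∀ b ∈ s, 1 ≤ b) {z : ℝ}
    (hz : z ∈ Set.Ioo (0 : ℝ) 1) :
    HasDerivAt (polylog ((a + 1) :: s)) (z⁻¹ * polylog (a :: s) z) z := by
  have hz1 : |z| < 1 := by rw [abs_of_pos hz.1]; exact hz.2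
  refine hasDerivAt_gf_theta (polyBdd_mzvPartial ?_).diffSeq (fun m => ?_) hz1 hz.1.ne'
  · simpa using hs
  · cases m with
    | zero => simp [diffSeq_mzvPartial_zero]
    | succ m =>
      rw [diffSeq_mzvPartial_succ, diffSeq_mzvPartial_succ]
      have : ((m + 1 : ℕ) : ℝ) ≠ 0 := by positivity
      field_simp
      ring

theorem hasDerivAt_polylog_one {s : List ℕ} (hs : ∀ b ∈ s, 1 ≤ b) {z : ℝ}
    (hz : z ∈ Set.Ioo (0 : ℝ) 1) :
    HasDerivAt (polylog (1 :: s)) ((1 - z)⁻¹ * polylog s z) z := by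
  have hz1 : |z| < 1 := by rw [abs_of_pos hz.1]; exact hz.2
  refine hasDerivAt_gf_diff (polyBdd_mzvPartial ?_).diffSeq (polyBdd_mzvPartial hs)
    (fun m => ?_) hz1
  · simpa using hs
  · rw [diffSeq_mzvPartial_succ]
    have : (m : ℝ) + 1 ≠ 0 := by positivity
    push_cast
    field_simp

theorem tendsto_polylog_zero {a : ℕ} {s : List ℕ} (ha : 1 ≤ a) (hs : ∀ b ∈ s, 1 ≤ b) :
    Tendsto (polylog (a :: s)) (𝓝[>] 0) (𝓝 0) := by
  have h := tendsto_gf_zero (polyBdd_mzvPartial (s := a :: s) (by simpa using ⟨ha, hs⟩)).diffSeq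
  rwa [diffSeq_mzvPartial_zero] at h

theorem tendsto_polylog_one {a : ℕ} {s : List ℕ} (ha : 2 ≤ a) (hs : ∀ b ∈ s, 1 ≤ b) :
    Tendsto (polylog (a :: s)) (𝓝[<] 1) (𝓝 (mzv (a :: s))) :=
  tendsto_gf_one (tendsto_mzvPartial ha hs)

theorem eqOn_of_hasDerivAt_eq {f g d : ℝ → ℝ} {c : ℝ}
    (hf : ∀ z ∈ Set.Ioo (0 : ℝ) 1, HasDerivAt f (d z) z)
    (hg : ∀ z ∈ Set.Ioo (0 : ℝ) 1, HasDerivAt g (d z) z)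
    (hf0 : Tendsto f (𝓝[>] 0) (𝓝 c)) (hg0 : Tendsto g (𝓝[>] 0) (𝓝 c)) :
    ∀ z ∈ Set.Ioo (0 : ℝ) 1, f z = g z := by
  intro z hz
  refine sub_eq_zero.1 (eq_zero_of_hasDerivAt_zero (f := fun z => f z - g z) (fun z hz => ?_) ?_ hz)
  · simpa using (hf z hz).fun_sub (hg z hz)
  · simpa using hf0.sub hg0

/-- The antisymmetrized product of the two solutions for `X` and `-X`. -/
noncomputable def antiProd (z : ℝ) : ℝ⟦X⟧ :=
  regSol z * evalNegHom (logSol z) - logSol z * evalNegHom (regSol z)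

/-- `z d/dz` of `antiProd`. -/
noncomputable def antiProdTheta (z : ℝ) : ℝ⟦X⟧ :=
  (regSolTheta z * evalNegHom (logSol z) + regSol z * evalNegHom (logSolTheta z))
    - (logSolTheta z * evalNegHom (regSol z) + logSol z * evalNegHom (regSolTheta z))

/-- `z d/dz` of `antiProdTheta`. -/
noncomputable def antiProdThetaTwo (z : ℝ) : ℝ⟦X⟧ :=
  2 * (regSolTheta z * evalNegHom (logSolTheta z))
    - 2 * (logSolTheta z * evalNegHom (regSolTheta z))

/-- `(1 - z) d/dz` of `antiProdThetaTwo`. -/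
noncomputable def antiProdThetaThree (z : ℝ) : ℝ⟦X⟧ :=
  2 * X * (regSol z * evalNegHom (logSolTheta z) - regSolTheta z * evalNegHom (logSol z))
    - 2 * X * (logSol z * evalNegHom (regSolTheta z) - logSolTheta z * evalNegHom (regSol z))

theorem isSolution_evalNeg_regSol :
    IsSolution (-X) (fun z => evalNegHom (regSol z)) (fun z => evalNegHom (regSolTheta z)) := by
  simpa only [evalNegHom_X] using isSolution_regSol.evalNeg

theorem isSolution_evalNeg_logSol :
    IsSolution (-X) (fun z => evalNegHom (logSol z)) (fun z => evalNegHom (logSolTheta z)) := by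
  simpa only [evalNegHom_X] using isSolution_logSol.evalNeg

theorem hasCoeffDerivAt_antiProd {z : ℝ} (hz : z ∈ Set.Ioo (0 : ℝ) 1) :
    HasCoeffDerivAt antiProd (C z⁻¹ * antiProdTheta z) z := by
  rw [antiProdTheta, mul_sub]
  exact (isSolution_regSol.deriv_mul isSolution_evalNeg_logSol hz).sub
    (isSolution_logSol.deriv_mul isSolution_evalNeg_regSol hz)

theorem hasCoeffDerivAt_antiProdTheta {z : ℝ} (hz : z ∈ Set.Ioo (0 : ℝ) 1) :
    HasCoeffDerivAt antiProdTheta (C z⁻¹ * antiProdThetaTwo z) z := by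
  rw [antiProdThetaTwo, mul_sub]
  exact (isSolution_regSol.deriv_sym isSolution_evalNeg_logSol hz).sub
    (isSolution_logSol.deriv_sym isSolution_evalNeg_regSol hz)

theorem hasCoeffDerivAt_antiProdThetaTwo {z : ℝ} (hz : z ∈ Set.Ioo (0 : ℝ) 1) :
    HasCoeffDerivAt antiProdThetaTwo (C (1 - z)⁻¹ * antiProdThetaThree z) z := by
  rw [antiProdThetaThree, mul_sub]
  exact (isSolution_regSol.deriv_two_mul isSolution_evalNeg_logSol hz).sub
    (isSolution_logSol.deriv_two_mul isSolution_evalNeg_regSol hz)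

theorem hasCoeffDerivAt_antiProdThetaThree {z : ℝ} (hz : z ∈ Set.Ioo (0 : ℝ) 1) :
    HasCoeffDerivAt antiProdThetaThree (C (1 - z)⁻¹ * (X * (X * (C (-4) * antiProd z)))) z := by
  have h : HasCoeffDerivAt antiProdThetaThree _ z := (isSolution_regSol.deriv_anti isSolution_evalNeg_logSol hz).sub
    (isSolution_logSol.deriv_anti isSolution_evalNeg_regSol hz)
  convert h using 1
  have h4 : (C (-4) : ℝ⟦X⟧) = -4 := by
    rw [map_neg]; exact congrArg Neg.neg (map_ofNat _ 4)
  rw [antiProd, h4]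
  ring

theorem tendsto_regSolTheta_mul_evalNeg_logSol :
    Tendsto (fun z => regSolTheta z * evalNegHom (logSol z)) (𝓝[>] 0) (𝓝 0) := by
  have h := ((tendsto_log_pow_mul_regSolTheta 1).mul (tendsto_evalNegHom tendsto_regSol_zero)).add
    (tendsto_regSolTheta_zero.mul (tendsto_evalNegHom tendsto_logPart_zero))
  simp only [zero_mul, add_zero] at h
  refine h.congr fun z => ?_
  rw [logSol, map_add, map_mul, evalNegHom_C, pow_one]
  ring

theorem tendsto_logSol_mul_evalNeg_regSolTheta :
    Tendsto (fun z => logSol z * evalNegHom (regSolTheta z)) (𝓝[>] 0) (𝓝 0) := by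
  have h := tendsto_evalNegHom tendsto_regSolTheta_mul_evalNeg_logSol
  simp only [map_mul, evalNegHom_evalNegHom, map_zero] at h
  exact h.congr fun z => mul_comm _ _

theorem tendsto_logSol_mul_regSolTheta :
    Tendsto (fun z => logSol z * regSolTheta z) (𝓝[>] 0) (𝓝 0) := by
  have h := ((tendsto_log_pow_mul_regSolTheta 1).mul tendsto_regSol_zero).add
    (tendsto_regSolTheta_zero.mul tendsto_logPart_zero)
  simp only [zero_mul, add_zero] at h
  refine h.congr fun z => ?_
  rw [logSol, pow_one]
  ring

/-- The divergent terms, log z times the product of the two regular solutions, cancel by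
antisymmetry. -/
theorem tendsto_antiProd_zero : Tendsto antiProd (𝓝[>] 0) (𝓝 0) := by
  have h := (tendsto_regSol_zero.mul (tendsto_evalNegHom tendsto_logPart_zero)).sub
    (tendsto_logPart_zero.mul (tendsto_evalNegHom tendsto_regSol_zero))
  simp only [map_zero, mul_zero, zero_mul, sub_zero] at h
  refine h.congr fun z => ?_
  rw [antiProd, logSol, map_add, map_mul, evalNegHom_C]
  ring

theorem tendsto_antiProdTheta_zero : Tendsto antiProdTheta (𝓝[>] 0) (𝓝 0) := by
  have h := (tendsto_regSolTheta_mul_evalNeg_logSol.add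
    (tendsto_regSol_zero.mul (tendsto_evalNegHom tendsto_logSolTheta_zero))).sub
    ((tendsto_logSolTheta_zero.mul (tendsto_evalNegHom tendsto_regSol_zero)).add
    tendsto_logSol_mul_evalNeg_regSolTheta)
  simp only [map_one, mul_one, zero_add, add_zero, sub_self] at h
  exact h

theorem tendsto_antiProdThetaTwo_zero : Tendsto antiProdThetaTwo (𝓝[>] 0) (𝓝 0) := by
  have h := ((tendsto_const_nhds (x := (2 : ℝ⟦X⟧))).mul
    (tendsto_regSolTheta_zero.mul (tendsto_evalNegHom tendsto_logSolTheta_zero))).sub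
    ((tendsto_const_nhds (x := (2 : ℝ⟦X⟧))).mul
    (tendsto_logSolTheta_zero.mul (tendsto_evalNegHom tendsto_regSolTheta_zero)))
  simp only [map_zero, mul_zero, zero_mul, sub_zero] at h
  exact h

theorem tendsto_antiProdThetaThree_zero :
    Tendsto antiProdThetaThree (𝓝[>] 0) (𝓝 (C 4 * X)) := by
  have h := ((tendsto_const_nhds (x := (2 * X : ℝ⟦X⟧))).mul
    ((tendsto_regSol_zero.mul (tendsto_evalNegHom tendsto_logSolTheta_zero)).sub
      tendsto_regSolTheta_mul_evalNeg_logSol)).sub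
    ((tendsto_const_nhds (x := (2 * X : ℝ⟦X⟧))).mul
    (tendsto_logSol_mul_evalNeg_regSolTheta.sub
      (tendsto_logSolTheta_zero.mul (tendsto_evalNegHom tendsto_regSol_zero))))
  have h4 : (C 4 : ℝ⟦X⟧) = 4 := map_ofNat _ 4
  have e : (2 * X * (1 * evalNegHom 1 - 0) - 2 * X * (0 - 1 * evalNegHom 1) : ℝ⟦X⟧)
      = C 4 * X := by
    rw [map_one, h4]; ring
  rw [e] at h
  exact h

theorem one_le_of_mem_stringPow_one_three (n : ℕ) : ∀ a ∈ stringPow [1, 3] n, 1 ≤ a :=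
  one_le_of_mem_stringPow (by simp) n

/-- Both sides of each identity have the same derivative and vanish at 0, so the identity descends
through the successive integrations that prefix 1, 2 and 3. -/
theorem coeff_antiProd_of_coeff_three {n : ℕ} {c : ℝ}
    (h : ∀ z ∈ Set.Ioo (0 : ℝ) 1,
      coeff (2 * n + 1) (antiProdThetaThree z) = c * polylog (stringPow [1, 3] n) z) :
    (∀ z ∈ Set.Ioo (0 : ℝ) 1,
      coeff (2 * n + 1) (antiProdTheta z) = c * polylog (2 :: stringPow [1, 3] n) z) ∧
    (∀ z ∈ Set.Ioo (0 : ℝ) 1,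
      coeff (2 * n + 1) (antiProd z) = c * polylog (3 :: stringPow [1, 3] n) z) := by
  have hs := one_le_of_mem_stringPow_one_three n
  have tz : ∀ {f : ℝ → ℝ⟦X⟧}, Tendsto f (𝓝[>] 0) (𝓝 0) →
      Tendsto (fun z => coeff (2 * n + 1) (f z)) (𝓝[>] 0) (𝓝 0) := fun hf => by
    simpa using (WithPiTopology.tendsto_iff_coeff_tendsto ..).1 hf (2 * n + 1)
  have pz : ∀ a, 1 ≤ a → Tendsto (fun z => c * polylog (a :: stringPow [1, 3] n) z)
      (𝓝[>] 0) (𝓝 0) := fun a ha => by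
    simpa using (tendsto_polylog_zero ha hs).const_mul c
  have h2 : ∀ z ∈ Set.Ioo (0 : ℝ) 1,
      coeff (2 * n + 1) (antiProdThetaTwo z) = c * polylog (1 :: stringPow [1, 3] n) z := by
    refine eqOn_of_hasDerivAt_eq (fun z hz => hasCoeffDerivAt_antiProdThetaTwo hz _)
      (fun z hz => ?_) (tz tendsto_antiProdThetaTwo_zero) (pz 1 le_rfl)
    rw [coeff_C_mul, h z hz, mul_left_comm]
    exact (hasDerivAt_polylog_one hs hz).const_mul c
  have h1 : ∀ z ∈ Set.Ioo (0 : ℝ) 1,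
      coeff (2 * n + 1) (antiProdTheta z) = c * polylog (2 :: stringPow [1, 3] n) z := by
    refine eqOn_of_hasDerivAt_eq (fun z hz => hasCoeffDerivAt_antiProdTheta hz _)
      (fun z hz => ?_) (tz tendsto_antiProdTheta_zero) (pz 2 (by norm_num))
    rw [coeff_C_mul, h2 z hz, mul_left_comm]
    exact (hasDerivAt_polylog_succ hs hz).const_mul c
  refine ⟨h1, eqOn_of_hasDerivAt_eq (fun z hz => hasCoeffDerivAt_antiProd hz _)
      (fun z hz => ?_) (tz tendsto_antiProd_zero) (pz 3 (by norm_num))⟩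
  rw [coeff_C_mul, h1 z hz, mul_left_comm]
  exact (hasDerivAt_polylog_succ hs hz).const_mul c

/-- The fourth differentiation brings a factor -4X², so two further powers of `X` correspond to
prepending 1,3 and multiplying by -4. The induction starts from the constant 4, the limit at 0 of
the coefficient of `X`. -/
theorem coeff_antiProdThetaThree (n : ℕ) : ∀ z ∈ Set.Ioo (0 : ℝ) 1,
    coeff (2 * n + 1) (antiProdThetaThree z) = 4 * (-4) ^ n * polylog (stringPow [1, 3] n) z := by
  have t := (WithPiTopology.tendsto_iff_coeff_tendsto ..).1 tendsto_antiProdThetaThree_zero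
  induction n with
  | zero =>
    refine eqOn_of_hasDerivAt_eq (d := fun _ => 0) (c := 4) (fun z hz => ?_) (fun z hz => ?_)
      ?_ ?_
    · simpa [coeff_succ_X_mul] using hasCoeffDerivAt_antiProdThetaThree hz 1
    · simpa [stringPow_zero, polylog_nil] using hasDerivAt_const z (4 : ℝ)
    · simpa using t 1
    · simp [stringPow_zero, polylog_nil]
  | succ n ih =>
    have h := (coeff_antiProd_of_coeff_three ih).2
    have hs := one_le_of_mem_stringPow_one_three n
    have hs' : ∀ b ∈ 3 :: stringPow [1, 3] n, 1 ≤ b := by simpa using hs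
    have e : stringPow [1, 3] (n + 1) = 1 :: 3 :: stringPow [1, 3] n := stringPow_succ _ _
    rw [e]
    refine eqOn_of_hasDerivAt_eq
      (fun z hz => hasCoeffDerivAt_antiProdThetaThree hz _) (fun z hz => ?_) (t _) ?_
    · rw [coeff_C_mul, show 2 * (n + 1) + 1 = 2 * n + 1 + 1 + 1 by ring, coeff_succ_X_mul,
        coeff_succ_X_mul, coeff_C_mul, h z hz]
      refine ((hasDerivAt_polylog_one hs' hz).const_mul (4 * (-4) ^ (n + 1))).congr_deriv ?_
      ring
    · have := (tendsto_polylog_zero le_rfl hs').const_mul (4 * (-4 : ℝ) ^ (n + 1))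
      rw [mul_zero] at this
      rw [coeff_C_mul, coeff_X, if_neg (by omega), mul_zero]
      exact this

theorem coeff_antiProdTheta_odd (n : ℕ) {z : ℝ} (hz : z ∈ Set.Ioo (0 : ℝ) 1) :
    coeff (2 * n + 1) (antiProdTheta z)
      = 4 * (-4) ^ n * polylog (2 :: stringPow [1, 3] n) z :=
  (coeff_antiProd_of_coeff_three (coeff_antiProdThetaThree n)).1 z hz

/-- Replacing X by -X swaps the two products, so the function is odd in `X`. -/
theorem coeff_antiProdTheta_even (n : ℕ) (z : ℝ) : coeff (2 * n) (antiProdTheta z) = 0 := by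
  have h : evalNegHom (antiProdTheta z) = -antiProdTheta z := by
    simp only [antiProdTheta, map_sub, map_add, map_mul, evalNegHom_evalNegHom]
    ring
  have h2 := congrArg (coeff (2 * n)) h
  simp only [evalNegHom, coeff_rescale, map_neg, pow_mul] at h2
  norm_num at h2
  linarith

/-- The value at `z = 1` of `antiProdTheta / (4 X)`. -/
noncomputable def cyclicSeries : ℝ⟦X⟧ :=
  mk fun n => if Even n then (-4) ^ (n / 2) * mzv (2 :: stringPow [1, 3] (n / 2)) else 0

theorem tendsto_antiProdTheta_one :
    Tendsto antiProdTheta (𝓝[<] 1) (𝓝 (X * (C 4 * cyclicSeries))) := by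
  rw [WithPiTopology.tendsto_iff_coeff_tendsto]
  intro n
  rcases Nat.even_or_odd' n with ⟨k, rfl | rfl⟩
  · simp only [coeff_antiProdTheta_even]
    cases k with
    | zero => simp
    | succ k =>
      rw [show 2 * (k + 1) = 2 * k + 1 + 1 by ring, coeff_succ_X_mul, coeff_C_mul, cyclicSeries,
        coeff_mk, if_neg (by simp), mul_zero]
      exact tendsto_const_nhds
  · rw [coeff_succ_X_mul, coeff_C_mul, cyclicSeries, coeff_mk, if_pos (by simp),
      Nat.mul_div_cancel_left k two_pos, ← mul_assoc]
    refine ((tendsto_polylog_one le_rfl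
      (one_le_of_mem_stringPow_one_three k)).const_mul _).congr' ?_
    filter_upwards [Ioo_mem_nhdsLT (zero_lt_one' ℝ)] with z hz
    rw [coeff_antiProdTheta_odd k hz]

/-! ### Connection between the endpoints 0 and 1 -/

theorem regSol_wronskian {z : ℝ} (hz : z ∈ Set.Ioo (0 : ℝ) 1) :
    regSol z * logSolTheta z - logSol z * regSolTheta z = 1 := by
  refine eq_of_tendsto_of_hasCoeffDerivAt_zero (l := 𝓝[>] 0)
    (fun z hz => isSolution_regSol.wronskian isSolution_logSol hz)
    (Ioo_mem_nhdsGT zero_lt_one) ?_ hz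
  have h := (tendsto_regSol_zero.mul tendsto_logSolTheta_zero).sub tendsto_logSol_mul_regSolTheta
  rwa [mul_one, sub_zero] at h

theorem tendsto_one_sub_one : Tendsto (fun z : ℝ => 1 - z) (𝓝[<] 1) (𝓝[>] 0) := by
  refine tendsto_nhdsWithin_iff.2 ⟨?_, ?_⟩
  · have : Tendsto (fun z : ℝ => 1 - z) (𝓝 1) (𝓝 (1 - 1)) :=
      (continuous_const.sub continuous_id).tendsto 1
    rw [sub_self] at this
    exact this.mono_left nhdsWithin_le_nhds
  · filter_upwards [self_mem_nhdsWithin] with z hz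
    exact Set.mem_Ioi.2 (sub_pos.2 (Set.mem_Iio.1 hz))

/-- A constant Wronskian of the reflected regular solution with the logarithmic one, evaluated by
letting z → 1. There `regSolTheta (1 - z)` vanishes to first order, which offsets the singularity of
`logSolTheta`. -/
theorem regSol_reflection {z : ℝ} (hz : z ∈ Set.Ioo (0 : ℝ) 1) :
    regSolTheta (1 - z) * logSolTheta z - logSol z * -(X * regSol (1 - z))
      = X * (C (-2) * (sineSeries * zetaSeries 1)) := by
  refine eq_of_tendsto_of_hasCoeffDerivAt_zero (l := 𝓝[<] 1)
    (fun z hz => isSolution_regSol.reflect.wronskian isSolution_logSol hz)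
    (Ioo_mem_nhdsLT zero_lt_one) ?_ hz
  have hb := coeffPolyBdd_sineProd.diffSeq.nat_mul
  have h1 := ((tendsto_coeffGf_zero hb.shift).comp tendsto_one_sub_one).mul
    tendsto_one_sub_mul_logSolTheta
  have h2 := tendsto_logSol_one.mul ((tendsto_const_nhds (x := (X : ℝ⟦X⟧))).mul
    (tendsto_regSol_zero.comp tendsto_one_sub_one)).neg
  have h := h1.sub h2
  rw [mul_zero, zero_sub, mul_one, mul_neg, neg_neg, mul_comm] at h
  refine h.congr' ?_
  filter_upwards [tendsto_one_sub_one.eventually eventually_abs_lt_one_zero] with z hz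
  rw [regSolTheta, coeffGf_eq_mul_shift hb (by simp) hz]
  simp only [Function.comp_apply]
  ring

/-- After expansion the bare log z terms cancel by antisymmetry. Every surviving logarithm
multiplies a factor that vanishes to first order. -/
theorem tendsto_logSol_anti_zero :
    Tendsto (fun z => evalNegHom (logSol z) * logSolTheta z
      - logSol z * evalNegHom (logSolTheta z)) (𝓝[>] 0) (𝓝 0) := by
  have hu := tendsto_regSol_zero
  have hw := tendsto_logPart_zero
  have hs := tendsto_logAux_zero
  have hq2 := tendsto_log_pow_mul_regSolTheta 2
  have hq1 := tendsto_log_pow_mul_regSolTheta 1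
  have hl := tendsto_log_mul_logAux
  have h := ((((tendsto_evalNegHom hu).mul hq2).sub (hu.mul (tendsto_evalNegHom hq2))).add
    (((tendsto_evalNegHom hu).mul hl).sub (hu.mul (tendsto_evalNegHom hl)))).add
    ((((tendsto_evalNegHom hw).mul hq1).sub (hw.mul (tendsto_evalNegHom hq1))).add
    (((tendsto_evalNegHom hw).mul (hs.sub hu)).sub (hw.mul (tendsto_evalNegHom (hs.sub hu)))))
  simp only [map_zero, mul_zero, zero_mul, sub_zero, add_zero] at h
  refine h.congr fun z => ?_
  simp only [logSol, logSolTheta, map_add, map_sub, map_mul, evalNegHom_C, map_pow]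
  ring

/-- Multiplying by u u* lets the Wronskians remove `logSolTheta z`. Multiplying by the values of
`logSolTheta` at 1-z, which tend to 1 as z → 1, lets the reflection relations remove `regSolTheta
z`. Everything left has a finite limit at 1. -/
theorem antiProdTheta_mul {z : ℝ} (hz : z ∈ Set.Ioo (0 : ℝ) 1) {k : ℝ⟦X⟧}
    (hk : k = X * (C (-2) * (sineSeries * zetaSeries 1))) :
    antiProdTheta z * (regSol z * evalNegHom (regSol z))
        * (logSolTheta (1 - z) * evalNegHom (logSolTheta (1 - z)))
      = (regSol z ^ 2 - evalNegHom (regSol z) ^ 2)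
          * (logSolTheta (1 - z) * evalNegHom (logSolTheta (1 - z)))
        + (evalNegHom (regSol z) * evalNegHom (logSolTheta (1 - z)) * k
          + regSol z * logSolTheta (1 - z) * evalNegHom k
          + X * (regSol z * evalNegHom (regSol z))
            * (evalNegHom (logSol (1 - z)) * logSolTheta (1 - z)
              - logSol (1 - z) * evalNegHom (logSolTheta (1 - z))))
          * (regSol z * evalNegHom (logSol z) - evalNegHom (regSol z) * logSol z) := by
  have hz' : 1 - z ∈ Set.Ioo (0 : ℝ) 1 := ⟨by linarith [hz.2], by linarith [hz.1]⟩
  have w1 := regSol_wronskian hz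
  have w2 := congrArg evalNegHom w1
  have r1 := regSol_reflection hz'
  rw [sub_sub_cancel, ← hk] at r1
  have r2 := congrArg evalNegHom r1
  simp only [map_sub, map_mul, map_one, map_neg, evalNegHom_X] at w2 r2
  rw [antiProdTheta]
  generalize regSol z = u at *
  generalize regSolTheta z = q at *
  generalize logSol z = v at *
  generalize logSolTheta z = p at *
  generalize logSol (1 - z) = v' at *
  generalize logSolTheta (1 - z) = p' at *
  generalize evalNegHom u = u₂ at *
  generalize evalNegHom q = q₂ at *
  generalize evalNegHom v = v₂ at *
  generalize evalNegHom p = p₂ at *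
  generalize evalNegHom v' = v₂' at *
  generalize evalNegHom p' = p₂' at *
  linear_combination p' * p₂' * (u ^ 2 * w2 - u₂ ^ 2 * w1)
    + (u * v₂ - u₂ * v) * (u₂ * p₂' * r1 + u * p' * r2)

theorem cyclicSeries_mul_sineSeries {d : ℝ⟦X⟧} (hd : d = C (-2) * (sineSeries * zetaSeries 1)) :
    X * (C 4 * cyclicSeries) * (sineSeries * evalNegHom sineSeries)
      = sineSeries ^ 2 - evalNegHom sineSeries ^ 2
        + (evalNegHom sineSeries * (X * d) + sineSeries * -(X * evalNegHom d))
          * (sineSeries * evalNegHom d - evalNegHom sineSeries * d) := by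
  have hu := tendsto_regSol_one
  have hu2 := tendsto_evalNegHom hu
  have hv := tendsto_logSol_one
  rw [← hd] at hv
  have hv2 := tendsto_evalNegHom hv
  have hp := tendsto_logSolTheta_zero.comp tendsto_one_sub_one
  have hp2 := tendsto_evalNegHom hp
  have ha := tendsto_logSol_anti_zero.comp tendsto_one_sub_one
  have hX := tendsto_const_nhds (x := (X : ℝ⟦X⟧)) (f := 𝓝[<] (1 : ℝ))
  have hk := tendsto_const_nhds (x := X * d) (f := 𝓝[<] (1 : ℝ))
  have hk2 := tendsto_const_nhds (x := evalNegHom (X * d)) (f := 𝓝[<] (1 : ℝ))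
  have hL := (tendsto_antiProdTheta_one.mul (hu.mul hu2)).mul (hp.mul hp2)
  have hR := (((hu.pow 2).sub (hu2.pow 2)).mul (hp.mul hp2)).add
    (((((hu2.mul hp2).mul hk).add ((hu.mul hp).mul hk2)).add ((hX.mul (hu.mul hu2)).mul ha)).mul
      ((hu.mul hv2).sub (hu2.mul hv)))
  have e := tendsto_nhds_unique (hL.congr' ?_) hR
  · simpa only [map_one, mul_one, mul_zero, add_zero, map_mul, evalNegHom_X, neg_mul] using e
  · filter_upwards [Ioo_mem_nhdsLT (zero_lt_one' ℝ)] with z hz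
    exact antiProdTheta_mul hz (by rw [hd])

/-! ### Bernoulli numbers, the hyperbolic cotangent and the inverse square of the product -/

theorem coeff_two_mul_of_odd_eq_zero (f : ℝ⟦X⟧) {g : ℝ⟦X⟧} (hg : ∀ n, coeff (2 * n + 1) g = 0)
    (n : ℕ) : coeff (2 * n) (f * g)
      = ∑ p ∈ Finset.HasAntidiagonal.antidiagonal n, coeff (2 * p.1) f * coeff (2 * p.2) g := by
  rw [coeff_mul]
  symm
  refine Finset.sum_of_injOn (fun p : ℕ × ℕ => (2 * p.1, 2 * p.2)) ?_ ?_ ?_ (fun _ _ => rfl)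
  · rintro ⟨a, b⟩ _ ⟨c, d⟩ _ h
    simp only [Prod.mk.injEq] at h ⊢
    omega
  · rintro ⟨a, b⟩ h
    simp only [Finset.mem_coe, Finset.HasAntidiagonal.mem_antidiagonal] at h ⊢
    omega
  · rintro ⟨a, b⟩ h h'
    rw [Finset.HasAntidiagonal.mem_antidiagonal] at h
    rcases Nat.even_or_odd' b with ⟨k, hk | hk⟩
    · refine absurd ⟨(n - k, k), ?_, ?_⟩ h'
      · simp only [Finset.mem_coe, Finset.HasAntidiagonal.mem_antidiagonal] at h ⊢
        omega
      · simp only [Prod.mk.injEq] at h ⊢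
        omega
    · simp only [hk, hg, mul_zero]

theorem coeff_X_mul_derivative (f : ℝ⟦X⟧) (n : ℕ) :
    coeff n (X * d⁄dX ℝ f) = n * coeff n f := by
  cases n with
  | zero => simp
  | succ n => rw [coeff_succ_X_mul, coeff_derivative, mul_comm]; push_cast; rfl

/-- Differentiate B (eˣ - 1) = X, multiply by B, and eliminate the exponential with the original
relation. -/
theorem bernoulliPowerSeries_riccati :
    X * d⁄dX ℝ (bernoulliPowerSeries ℝ) + bernoulliPowerSeries ℝ ^ 2
      + X * bernoulliPowerSeries ℝ = bernoulliPowerSeries ℝ := by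
  have h := bernoulliPowerSeries_mul_exp_sub_one ℝ
  have h' := congrArg (d⁄dX ℝ) h
  simp only [Derivation.leibniz, map_sub, derivative_exp, derivative_X, smul_eq_mul,
    derivative_one, sub_zero] at h'
  linear_combination (-(d⁄dX ℝ (bernoulliPowerSeries ℝ)) - bernoulliPowerSeries ℝ) * h
    + bernoulliPowerSeries ℝ * h'

/-- The even part of the generating series of the Bernoulli numbers. -/
noncomputable def bernoulliEven : ℝ⟦X⟧ := bernoulliPowerSeries ℝ + C (1 / 2) * X

theorem coeff_bernoulliEven_odd (n : ℕ) : coeff (2 * n + 1) bernoulliEven = 0 := by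
  rw [bernoulliEven, map_add, coeff_C_mul, coeff_X, bernoulliPowerSeries, coeff_mk]
  cases n with
  | zero => norm_num
  | succ n =>
    rw [bernoulli_eq_zero_of_odd (by simp) (by omega), if_neg (by omega)]
    simp

theorem coeff_bernoulliEven_even (n : ℕ) :
    coeff (2 * n) bernoulliEven = (bernoulli (2 * n) : ℝ) / (2 * n).factorial := by
  rw [bernoulliEven, map_add, coeff_C_mul, coeff_X, bernoulliPowerSeries, coeff_mk,
    if_neg (by omega)]
  simp

theorem bernoulliEven_riccati :
    bernoulliEven ^ 2 = bernoulliEven - X * d⁄dX ℝ bernoulliEven + C (1 / 4) * X ^ 2 := by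
  have h := bernoulliPowerSeries_riccati
  have e2 : (C (1 / 2) : ℝ⟦X⟧) * 2 = 1 := by
    rw [← map_ofNat (C (R := ℝ)) 2, ← map_mul]; norm_num
  have e4 : (C (1 / 4) : ℝ⟦X⟧) = C (1 / 2) * C (1 / 2) := by
    rw [← map_mul]; norm_num
  have hd : d⁄dX ℝ bernoulliEven = d⁄dX ℝ (bernoulliPowerSeries ℝ) + C (1 / 2) := by
    simp only [bernoulliEven, map_add, Derivation.leibniz, derivative_C, derivative_X, smul_eq_mul]
    ring
  rw [hd, e4, bernoulliEven]
  linear_combination h + (X * bernoulliPowerSeries ℝ) * e2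

/-- Coefficient of X²ⁿ in the Riccati equation. The condition on `n` avoids the term X²/4. -/
theorem sum_antidiagonal_bernoulli {n : ℕ} (hn : 2 ≤ n) :
    ∑ p ∈ Finset.HasAntidiagonal.antidiagonal n, ((bernoulli (2 * p.1) : ℝ) / (2 * p.1).factorial)
        * ((bernoulli (2 * p.2) : ℝ) / (2 * p.2).factorial)
      = (1 - 2 * n) * ((bernoulli (2 * n) : ℝ) / (2 * n).factorial) := by
  have h := congrArg (coeff (2 * n)) bernoulliEven_riccati
  rw [pow_two, coeff_two_mul_of_odd_eq_zero _ coeff_bernoulliEven_odd, map_add, map_sub,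
    coeff_X_mul_derivative, coeff_C_mul, coeff_X_pow, if_neg (by omega)] at h
  simp only [coeff_bernoulliEven_even] at h
  rw [h]
  push_cast
  ring

theorem mzv_two_mul {k : ℕ} (hk : k ≠ 0) :
    mzv [2 * k] = (-1 : ℝ) ^ (k + 1) * (2 : ℝ) ^ (2 * k - 1) * Real.pi ^ (2 * k)
      * (bernoulli (2 * k) : ℝ) / (2 * k).factorial := by
  have h := ((hasSum_nat_add_iff' 1).2 (hasSum_zeta_nat hk)).tendsto_sum_nat
  refine tendsto_nhds_unique (tendsto_mzvPartial (by omega) (by simp)) ?_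
  simpa [mzvPartial, hk] using h

/-- The power series `π√X coth (π√X) = 1 + 2 ∑ (-1)ʲ⁺¹ ζ(2j) Xʲ`. -/
noncomputable def cothSeries : ℝ⟦X⟧ := 1 + C 2 * zetaSeries 0

theorem coeff_cothSeries (n : ℕ) : coeff n cothSeries
    = (2 * Real.pi) ^ (2 * n) * ((bernoulli (2 * n) : ℝ) / (2 * n).factorial) := by
  rw [cothSeries, map_add, coeff_C_mul, zetaSeries, coeff_mk]
  cases n with
  | zero => simp
  | succ n =>
    rw [if_neg n.succ_ne_zero, coeff_one, if_neg n.succ_ne_zero, add_zero,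
      mzv_two_mul (k := n + 1) n.succ_ne_zero, mul_pow, show 2 * (n + 1) - 1 = 2 * n + 1 by omega,
      show 2 * (n + 1) = 2 * n + 1 + 1 by ring, pow_succ (2 : ℝ) (2 * n + 1)]
    have h1 : ((-1 : ℝ) ^ (n + 1)) * (-1 : ℝ) ^ (n + 1 + 1) = -1 := by
      rw [pow_succ _ (n + 1), ← mul_assoc, ← mul_pow]; norm_num
    linear_combination (-2 * ((2 : ℝ) ^ (2 * n + 1) * Real.pi ^ (2 * n + 1 + 1)
      * bernoulli (2 * n + 1 + 1) / (2 * n + 1 + 1).factorial)) * h1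

theorem cothSeries_riccati : ∃ κ : ℝ,
    cothSeries ^ 2 = cothSeries - C 2 * (X * d⁄dX ℝ cothSeries) + C κ * X := by
  -- κ is whatever makes the coefficients of `X` agree. Its value, π² in closed form, is never
  -- needed.
  obtain ⟨κ, hκ⟩ : ∃ κ, κ = coeff 1 (cothSeries ^ 2) - coeff 1 cothSeries
    + 2 * coeff 1 cothSeries := ⟨_, rfl⟩
  refine ⟨κ, ?_⟩
  ext n
  simp only [map_add, map_sub, coeff_C_mul, coeff_X_mul_derivative]
  rcases Nat.lt_or_ge n 2 with hn | hn
  · interval_cases n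
    · rw [pow_two, coeff_mul]
      simp [coeff_cothSeries]
    · rw [coeff_one_X, hκ]
      push_cast
      ring
  · have h := sum_antidiagonal_bernoulli hn
    rw [coeff_X, if_neg (by omega), pow_two, coeff_mul]
    have h2 : ∑ p ∈ Finset.HasAntidiagonal.antidiagonal n, coeff p.1 cothSeries * coeff p.2 cothSeries
        = (2 * Real.pi) ^ (2 * n) * ∑ p ∈ Finset.HasAntidiagonal.antidiagonal n,
          ((bernoulli (2 * p.1) : ℝ) / (2 * p.1).factorial)
          * ((bernoulli (2 * p.2) : ℝ) / (2 * p.2).factorial) := by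
      rw [Finset.mul_sum]
      refine Finset.sum_congr rfl fun p hp => ?_
      rw [coeff_cothSeries, coeff_cothSeries, ← Finset.HasAntidiagonal.mem_antidiagonal.1 hp, mul_add, pow_add]
      ring
    rw [h2, h, coeff_cothSeries]
    ring

/-- Each factor 1 + X/k² has logarithmic derivative X/(k² + X) under X d/dX. -/
theorem X_mul_derivative_sineProd (m : ℕ) :
    X * d⁄dX ℝ (sineProd m) = zetaPartial 0 m * sineProd m := by
  induction m with
  | zero =>
    have : zetaPartial 0 0 = 0 := by ext n; simp [zetaPartial, mzvPartial]
    simp [sineProd, this]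
  | succ m ih =>
    have h := zetaPartial_succ_sub 0 m
    rw [add_zero] at h
    rw [sineProd_succ]
    simp only [Derivation.leibniz, map_add, derivative_C, derivative_X, smul_eq_mul,
      derivative_one]
    linear_combination (1 + C ((((m + 1 : ℕ) : ℝ)) ^ 2)⁻¹ * X) * ih - sineProd m * h

theorem X_mul_derivative_sineSeries :
    X * d⁄dX ℝ sineSeries = zetaSeries 0 * sineSeries := by
  have h : Tendsto (fun m => X * d⁄dX ℝ (sineProd m)) atTop (𝓝 (X * d⁄dX ℝ sineSeries)) := by
    have h0 := (WithPiTopology.tendsto_iff_coeff_tendsto ..).1 tendsto_sineProd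
    rw [WithPiTopology.tendsto_iff_coeff_tendsto]
    intro n
    simp only [coeff_X_mul_derivative]
    exact (h0 n).const_mul _
  simp only [X_mul_derivative_sineProd] at h
  exact tendsto_nhds_unique h ((tendsto_zetaPartial 0).mul tendsto_sineProd)

theorem constantCoeff_sineSeries : constantCoeff sineSeries = 1 := by
  rw [← coeff_zero_eq_constantCoeff_apply, sineSeries, coeff_mk, stringPow_zero, mzv_nil]

/-- With E = `cothSeries` and P = `sineSeries`, Riccati turns the second factor into E² - κX. Under
X d/dX it is multiplied by 1 - E, while P² is multiplied by E - 1. The product is therefore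
constant, equal to its constant term 1. -/
theorem sineSeries_sq_mul :
    sineSeries ^ 2 * (cothSeries - C 2 * (X * d⁄dX ℝ cothSeries)) = 1 := by
  obtain ⟨κ, hκ⟩ := cothSeries_riccati
  have hP := X_mul_derivative_sineSeries
  have hc : cothSeries = 1 + 2 * zetaSeries 0 := by
    rw [cothSeries]; congr 2
  have h2 : (C 2 : ℝ⟦X⟧) = 2 := map_ofNat _ 2
  have e : cothSeries - C 2 * (X * d⁄dX ℝ cothSeries) = cothSeries ^ 2 - C κ * X := by
    rw [hκ]; ring
  rw [e]
  have hR : X * d⁄dX ℝ (sineSeries ^ 2 * (cothSeries ^ 2 - C κ * X)) = 0 := by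
    simp only [Derivation.leibniz, map_sub, derivative_pow, derivative_C, derivative_X,
      smul_eq_mul]
    rw [h2] at hκ
    push_cast
    generalize d⁄dX ℝ sineSeries = P' at *
    generalize d⁄dX ℝ cothSeries = e' at *
    linear_combination (2 * sineSeries * (cothSeries ^ 2 - C κ * X)) * hP
      - (sineSeries ^ 2 * (cothSeries ^ 2 - C κ * X)) * hc + sineSeries ^ 2 * cothSeries * hκ
  ext n
  cases n with
  | zero =>
    have h1 : constantCoeff cothSeries = 1 := by
      rw [← coeff_zero_eq_constantCoeff_apply, coeff_cothSeries]; simp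
    simp [constantCoeff_sineSeries, h1]
  | succ n =>
    have h := congrArg (coeff (n + 1)) hR
    rw [coeff_X_mul_derivative, map_zero] at h
    rw [coeff_one, if_neg n.succ_ne_zero]
    exact (mul_eq_zero.1 h).resolve_left (by positivity)

/-! ### Closed form of the generating series -/

/-- The series `∑ (4k + 1) ζ(4k + 2) X²ᵏ`. -/
noncomputable def evenZetaSeries : ℝ⟦X⟧ :=
  mk fun n => if Even n then (2 * (n : ℝ) + 1) * mzv [2 * n + 2] else 0

/-- The series `∑ ζ(4k + 3) X²ᵏ`. -/
noncomputable def oddZetaSeries : ℝ⟦X⟧ :=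
  mk fun n => if Even n then mzv [2 * n + 3] else 0

/-- The operator 1 - 2X d/dX multiplies the coefficient of X²ᵏ⁺¹ by -(4k + 1), the source of that
weight in the theorem. Only odd powers of `X` survive the difference. -/
theorem evalNeg_sub_coth :
    evalNegHom (cothSeries - C 2 * (X * d⁄dX ℝ cothSeries))
      - (cothSeries - C 2 * (X * d⁄dX ℝ cothSeries)) = C 4 * (X * evenZetaSeries) := by
  ext n
  rw [map_sub, evalNegHom, coeff_rescale, map_sub, coeff_C_mul, coeff_X_mul_derivative,
    coeff_C_mul, cothSeries, map_add, coeff_C_mul, zetaSeries, coeff_mk]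
  cases n with
  | zero => simp
  | succ n =>
    rw [if_neg n.succ_ne_zero, coeff_one, if_neg n.succ_ne_zero, coeff_succ_X_mul, evenZetaSeries,
      coeff_mk]
    rcases Nat.even_or_odd n with hn | hn
    · rw [if_pos hn, hn.add_one.neg_one_pow, show 2 * (n + 1) + 0 = 2 * n + 2 by ring]
      push_cast
      ring
    · rw [if_neg (Nat.not_even_iff_odd.2 hn), hn.add_one.neg_one_pow]
      ring

theorem evalNeg_sub_zetaSeries :
    evalNegHom (zetaSeries 1) - zetaSeries 1 = C (-2) * (X * oddZetaSeries) := by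
  ext n
  rw [map_sub, evalNegHom, coeff_rescale, coeff_C_mul, zetaSeries, coeff_mk]
  cases n with
  | zero => simp
  | succ n =>
    rw [if_neg n.succ_ne_zero, coeff_succ_X_mul, oddZetaSeries, coeff_mk]
    rcases Nat.even_or_odd n with hn | hn
    · rw [if_pos hn, hn.add_one.neg_one_pow, show 2 * (n + 1) + 1 = 2 * n + 3 by ring]
      ring
    · rw [if_neg (Nat.not_even_iff_odd.2 hn), hn.add_one.neg_one_pow]
      ring

theorem cyclicSeries_eq :
    cyclicSeries = (evenZetaSeries - C 4 * (X * (X * (oddZetaSeries * oddZetaSeries))))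
      * (sineSeries * evalNegHom sineSeries) := by
  have h := cyclicSeries_mul_sineSeries rfl
  have g1 := sineSeries_sq_mul
  have g2 := congrArg evalNegHom g1
  have hg := evalNeg_sub_coth
  have ht := evalNeg_sub_zetaSeries
  simp only [map_mul, evalNegHom_C, map_pow, map_one] at h g2
  have h0 : constantCoeff (evalNegHom sineSeries) = 1 := by
    rw [← coeff_zero_eq_constantCoeff_apply, evalNegHom, coeff_rescale, pow_zero, one_mul,
      coeff_zero_eq_constantCoeff_apply, constantCoeff_sineSeries]
  have h1 : sineSeries ≠ 0 := fun h => by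
    have := constantCoeff_sineSeries; rw [h] at this; simp at this
  have h2 : evalNegHom sineSeries ≠ 0 := fun h => by rw [h] at h0; simp at h0
  have h4 : (C 4 : ℝ⟦X⟧) = 4 := map_ofNat _ 4
  have h4' : (4 : ℝ⟦X⟧) ≠ 0 := by
    rw [← h4]; intro h; have := congrArg constantCoeff h; simp at this
  have hm2 : (C (-2) : ℝ⟦X⟧) = -2 := by
    rw [map_neg]; exact congrArg Neg.neg (map_ofNat _ 2)
  -- Both sides acquire this common factor once P² - P*² is written as P² P*² (1/P*² - 1/P²), so it
  -- can be cancelled in the domain of power series.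
  have hne : 4 * X * (sineSeries * evalNegHom sineSeries) ≠ 0 :=
    mul_ne_zero (mul_ne_zero h4' X_ne_zero) (mul_ne_zero h1 h2)
  refine mul_left_cancel₀ hne ?_
  rw [h4] at h hg ⊢
  rw [hm2] at h ht
  generalize evalNegHom (cothSeries - C 2 * (X * d⁄dX ℝ cothSeries)) = g' at *
  generalize cothSeries - C 2 * (X * d⁄dX ℝ cothSeries) = g at *
  generalize evalNegHom (zetaSeries 1) = t' at *
  generalize zetaSeries 1 = t at *
  generalize evalNegHom sineSeries = P' at *
  generalize sineSeries = P at *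
  linear_combination h + P' ^ 2 * g1 - P ^ 2 * g2 + P ^ 2 * P' ^ 2 * hg
    - 4 * X * P ^ 2 * P' ^ 2 * (t' - t + (-2 * (X * oddZetaSeries))) * ht

/-! ### The quartic product and comparison of coefficients -/

/-- The partial products of `∏ (1 - X² / k⁴)`. -/
noncomputable def quarticPartial (m : ℕ) : ℝ⟦X⟧ :=
  mk fun n => if Even n then (-1) ^ (n / 2) * mzvPartial (stringPow [4] (n / 2)) m else 0

/-- The series `∑ (-1)ᵏ ζ({4}ᵏ) X²ᵏ`. -/
noncomputable def quarticSeries : ℝ⟦X⟧ :=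
  mk fun n => if Even n then (-1) ^ (n / 2) * mzv (stringPow [4] (n / 2)) else 0

theorem tendsto_quarticPartial : Tendsto quarticPartial atTop (𝓝 quarticSeries) := by
  rw [WithPiTopology.tendsto_iff_coeff_tendsto]
  intro n
  simp only [quarticPartial, quarticSeries, coeff_mk]
  split_ifs
  · exact (tendsto_mzvPartial_stringPow_singleton (by norm_num) _).const_mul _
  · exact tendsto_const_nhds

theorem quarticPartial_succ (m : ℕ) : quarticPartial (m + 1)
    = quarticPartial m - X * (X * (C ((((m + 1 : ℕ) : ℝ)) ^ 4)⁻¹ * quarticPartial m)) := by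
  ext n
  rw [map_sub]
  match n with
  | 0 => simp [quarticPartial, stringPow_zero, mzvPartial]
  | 1 =>
    refine Eq.trans ?_ (congrArg₂ (· - ·) rfl (coeff_succ_X_mul 0 _).symm)
    simp [quarticPartial]
  | n + 2 =>
    rw [coeff_succ_X_mul, coeff_succ_X_mul, coeff_C_mul]
    simp only [quarticPartial, coeff_mk]
    rcases Nat.even_or_odd' n with ⟨k, rfl | rfl⟩
    · have h1 : Even (2 * k + 2) := ⟨k + 1, by ring⟩
      simp only [h1, even_two_mul, if_true]
      rw [show (2 * k + 2) / 2 = k + 1 by omega, show 2 * k / 2 = k by omega, stringPow_succ,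
        List.singleton_append, mzvPartial_cons_succ]
      ring
    · have h1 : ¬Even (2 * k + 1) := Nat.not_even_two_mul_add_one k
      have h2 : ¬Even (2 * k + 1 + 2) := Nat.not_even_two_mul_add_one (k + 1)
      simp only [h1, h2, if_false]
      ring

/-- Factorwise, (1 + X/k²)(1 - X/k²) = 1 - X²/k⁴. -/
theorem sineProd_mul_evalNeg (m : ℕ) :
    sineProd m * evalNegHom (sineProd m) = quarticPartial m := by
  induction m with
  | zero =>
    ext n
    simp only [sineProd, Finset.range_zero, Finset.prod_empty, map_one, mul_one, coeff_one,
      quarticPartial, coeff_mk]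
    rcases Nat.even_or_odd' n with ⟨k, rfl | rfl⟩
    · cases k with
      | zero => simp [stringPow_zero, mzvPartial]
      | succ k => simp [stringPow_succ, mzvPartial]
    · simp
  | succ m ih =>
    have h : (C ((((m + 1 : ℕ) : ℝ)) ^ 4)⁻¹ : ℝ⟦X⟧)
        = C ((((m + 1 : ℕ) : ℝ)) ^ 2)⁻¹ * C ((((m + 1 : ℕ) : ℝ)) ^ 2)⁻¹ := by
      rw [← map_mul, ← mul_inv]
      congr 2
      ring
    rw [quarticPartial_succ, ← ih, sineProd_succ, h]
    simp only [map_mul, map_add, map_one, evalNegHom_C, evalNegHom_X]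
    ring

theorem sineSeries_mul_evalNeg : sineSeries * evalNegHom sineSeries = quarticSeries := by
  refine tendsto_nhds_unique (tendsto_sineProd.mul (tendsto_evalNegHom tendsto_sineProd)) ?_
  simpa only [sineProd_mul_evalNeg] using tendsto_quarticPartial

theorem coeff_oddZetaSeries_sq (k : ℕ) :
    coeff (2 * k) (X * (X * (oddZetaSeries * oddZetaSeries)))
      = ∑ j ∈ Finset.Icc 1 k, mzv [4 * j - 1] * mzv [4 * k - 4 * j + 3] := by
  cases k with
  | zero => simp
  | succ k =>
    rw [show 2 * (k + 1) = 2 * k + 1 + 1 by ring, coeff_succ_X_mul, coeff_succ_X_mul,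
      coeff_two_mul_of_odd_eq_zero _ (fun n => by simp [oddZetaSeries]),
      Finset.Nat.sum_antidiagonal_eq_sum_range_succ
        (fun i j => coeff (2 * i) oddZetaSeries * coeff (2 * j) oddZetaSeries),
      Finset.range_eq_Ico, ← Finset.Ico_add_one_right_eq_Icc,
      ← Finset.sum_Ico_add' (fun j => mzv [4 * j - 1] * mzv [4 * (k + 1) - 4 * j + 3]) 0 (k + 1) 1]
    refine Finset.sum_congr rfl fun j hj => ?_
    have hj' := (Finset.mem_Ico.1 hj).2
    simp only [oddZetaSeries, coeff_mk, even_two_mul, if_true]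
    -- The two factors of `X` account for the index shift j ↦ j + 1, which turns 4j + 3 into 4(j+1)
    -- - 1.
    rw [show 2 * (2 * j) + 3 = 4 * (j + 1) - 1 by omega,
      show 2 * (2 * (k - j)) + 3 = 4 * (k + 1) - 4 * (j + 1) + 3 by omega]

theorem neg_four_pow_mul_mzv (n : ℕ) :
    (-4) ^ n * mzv (2 :: stringPow [1, 3] n) = ∑ k ∈ Finset.range (n + 1),
      ((4 * (k : ℝ) + 1) * mzv [4 * k + 2]
        - 4 * ∑ j ∈ Finset.Icc 1 k, mzv [4 * j - 1] * mzv [4 * k - 4 * j + 3])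
        * ((-1) ^ (n - k) * mzv (stringPow [4] (n - k))) := by
  have h := congrArg (coeff (2 * n)) cyclicSeries_eq
  rw [sineSeries_mul_evalNeg, coeff_two_mul_of_odd_eq_zero _ (fun n => by simp [quarticSeries]),
    Finset.Nat.sum_antidiagonal_eq_sum_range_succ (fun i j =>
      coeff (2 * i) (evenZetaSeries - C 4 * (X * (X * (oddZetaSeries * oddZetaSeries))))
        * coeff (2 * j) quarticSeries)] at h
  simp only [map_sub, coeff_C_mul, coeff_oddZetaSeries_sq, cyclicSeries, evenZetaSeries,
    quarticSeries, coeff_mk, even_two_mul, if_true, Nat.mul_div_cancel_left _ two_pos] at h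
  rw [h]
  refine Finset.sum_congr rfl fun k _ => ?_
  rw [show 2 * (2 * k) + 2 = 4 * k + 2 by ring]
  push_cast
  ring

theorem mainTheorem4 (n : ℕ) :
    MZVConverges (2 :: stringPow [1, 3] n) ∧
    (∀ m : ℕ, MZVConverges (stringPow [4] m)) ∧
    (∀ m : ℕ, 2 ≤ m → MZVConverges [m]) ∧
    mzv (2 :: stringPow [1, 3] n) =
      ((4 : ℝ) ^ n)⁻¹ * ∑ k ∈ Finset.range (n + 1),
        (-1 : ℝ) ^ k * mzv (stringPow [4] (n - k)) *
          ((4 * (k : ℝ) + 1) * mzv [4 * k + 2] -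
            4 * ∑ j ∈ Finset.Icc 1 k, mzv [4 * j - 1] * mzv [4 * k - 4 * j + 3]) := by
  refine ⟨.of_two_le le_rfl (one_le_of_mem_stringPow_one_three n),
    .stringPow_singleton (by norm_num), fun m hm => .of_two_le hm (by simp), ?_⟩
  have h := neg_four_pow_mul_mzv n
  rw [eq_inv_mul_iff_mul_eq₀ (by positivity)]
  -- The sign (-1)ⁿ split off here combines with (-1)ⁿ⁻ᵏ from the quartic product to give (-1)ᵏ.
  have h4 : (4 : ℝ) ^ n = (-1) ^ n * (-4) ^ n := by rw [← mul_pow]; norm_num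
  rw [h4, mul_assoc, h, Finset.mul_sum]
  refine Finset.sum_congr rfl fun k hk => ?_
  have hs : (-1 : ℝ) ^ n * (-1) ^ (n - k) = (-1) ^ k := by
    obtain ⟨j, rfl⟩ := Nat.exists_eq_add_of_le (Nat.lt_succ_iff.1 (Finset.mem_range.1 hk))
    rw [Nat.add_sub_cancel_left, pow_add, mul_assoc, ← mul_pow]
    norm_num
  rw [← hs]
  ring
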